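/- Let $d\ge 1$ and let $P\subset\mathbb{R}^d$ be a $d$-dimensional space-filling zonotope; that is, $P$ is a translate of a Minkowski sum of finitely many segments $[\mathbf 0,\mathbf v_i]$, it has nonempty interior, and $\mathbb{R}^d$ can be tiled by translates of $P$ (the translates cover $\mathbb{R}^d$ and have pairwise disjoint interiors). A facet of $P$ is a $(d-1)$-dimensional face and a ridge is a $(d-2)$-dimensional face. The belt of a ridge $R$ is the set of all facets of $P$ that are parallel to $R$. A belt path of length $n\ge 0$ between two facets $F$ and $G$ is a sequence $F=F_0,\mathcal B_1,F_1,\mathcal B_2,\dots,\mathcal B_n,F_n=G$ of facets $F_i$ and belts $\mathcal B_i$ such that $F_{i-1},F_i\in\mathcal B_i$ for $1\le i\le n$. The belt distance between $F$ and $G$ is $0$ if they are opposite (exchanged by the central symmetry of $P$), and is otherwise the least length of a belt path between them. The belt diameter of $P$ is the maximal belt distance between two facets of $P$. Then any two non-opposite facets of $P$ are joined by a belt path, and the belt diameter of $P$ is at most $\left\lceil \log_2\frac{4d}{5}\right\rceil$. -/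

import Mathlib

open scoped Pointwise

namespace SpaceFilling

variable {E : Type*} [NormedAddCommGroup E] [NormedSpace ℝ E]

/-- A polytope: the convex hull of finitely many points. -/
def IsPolytope (P : Set E) : Prop :=
  ∃ s : Finset E, P = convexHull ℝ (s : Set E)

/-- A zonotope: a translate of a Minkowski sum of finitely many segments `[0, vᵢ]`. -/
def IsZonotope (P : Set E) : Prop :=
  ∃ (n : ℕ) (v : Fin n → E) (c : E), P = c +ᵥ ∑ i, segment ℝ (0 : E) (v i)

/-- The translates `t + P`, `t ∈ T`, tile the space: they cover it, and two different ones have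
no common interior point. The tiling need not be face-to-face and `T` need not be a lattice. -/
def IsTranslativeTiling (P : Set E) (T : Set E) : Prop :=
  (⋃ t ∈ T, (t +ᵥ P)) = Set.univ ∧
    T.Pairwise fun s t => Disjoint (interior (s +ᵥ P)) (interior (t +ᵥ P))

/-- A parallelohedron (space-filling polytope): a full-dimensional polytope that tiles the space
by translates. -/
structure IsParallelohedron (P : Set E) : Prop where
  isPolytope : IsPolytope P
  full_dimensional : (interior P).Nonempty
  exists_tiling : ∃ T : Set E, IsTranslativeTiling P T

/-- The dimension of a nonempty convex set, that is, of its affine hull. -/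
noncomputable def dim (A : Set E) : ℕ := Module.finrank ℝ (vectorSpan ℝ A)

/-- A (nonempty) face: the set of all points of `P` at which a linear functional attains its
maximum over `P`, that is, the intersection of `P` with a supporting hyperplane. (The zero
functional gives `P` itself, which is neither a facet nor a ridge.) -/
def IsFace (P F : Set E) : Prop := IsExposed ℝ P F ∧ F.Nonempty

/-- A facet: a face of codimension one. -/
def IsFacet (P F : Set E) : Prop := IsFace P F ∧ dim F + 1 = dim P

/-- A ridge: a face of codimension two. -/
def IsRidge (P R : Set E) : Prop := IsFace P R ∧ dim R + 2 = dim P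

/-- The set of all facets of `P` parallel to `R`. -/
def belt (P R : Set E) : Set (Set E) :=
  {F | IsFacet P F ∧ vectorSpan ℝ R ≤ vectorSpan ℝ F}

/-- The belts of `P` are the sets of facets parallel to one of its ridges. -/
def IsBelt (P : Set E) (B : Set (Set E)) : Prop := ∃ R, IsRidge P R ∧ B = belt P R

/-- `F 0, B 0, F 1, B 1, …, B (n - 1), F n` is a belt path of length `n` on `P`: each `F i` is a
facet, each `B i` is a belt, and `B i` contains both `F i` and `F (i + 1)`. -/
structure IsBeltPath (P : Set E) {n : ℕ} (F : Fin (n + 1) → Set E)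
    (B : Fin n → Set (Set E)) : Prop where
  isFacet : ∀ i, IsFacet P (F i)
  isBelt : ∀ i, IsBelt P (B i)
  left_mem : ∀ i : Fin n, F i.castSucc ∈ B i
  right_mem : ∀ i : Fin n, F i.succ ∈ B i

/-- `F` and `G` are exchanged by a central symmetry of `P`. -/
def AreOpposite (P F G : Set E) : Prop :=
  ∃ c : E, AffineEquiv.pointReflection ℝ c '' P = P ∧ AffineEquiv.pointReflection ℝ c '' F = G

open Classical in
/-- The belt distance between two facets: `0` for opposite facets, and otherwise the least length
of a belt path from one to the other (`⊤` if there is none). -/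
noncomputable def beltDist (P F G : Set E) : ℕ∞ :=
  if AreOpposite P F G then 0
  else sInf {k : ℕ∞ | ∃ (n : ℕ) (Φ : Fin (n + 1) → Set E) (B : Fin n → Set (Set E)),
    IsBeltPath P Φ B ∧ Φ 0 = F ∧ Φ (Fin.last n) = G ∧ k = n}

/-- The belt diameter: the maximal belt distance between two facets. -/
noncomputable def beltDiameter (P : Set E) : ℕ∞ :=
  ⨆ (F : Set E) (_ : IsFacet P F) (G : Set E) (_ : IsFacet P G), beltDist P F G

end SpaceFilling

namespace SpaceFilling

/-! ### Distances between flat hyperplanes of a vector configuration. -/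

section Flats

open Module Submodule

variable {V : Type*} [AddCommGroup V] [Module ℝ V]

/-! The problem becomes linear algebra on the generators `u i`. The face of a zonotope maximising
`f` has as direction space the span of the generators killed by `f` (`vectorSpan_zonoFace`). So
facets, up to opposition, correspond to hyperplanes spanned by generators, ridge directions
correspond to flats of codimension two, and a belt path is a chain of hyperplanes in which
consecutive ones share such a flat.

Tiling enters only through `BeltCondition` (`IsTranslativeTiling.beltCondition`): at most three
hyperplanes through a given codimension-two flat cover all generators. No face-to-face assumption is
made. At a suitable point `x` of a ridge of a tile, take the tiles across the two facets meeting
there. The two facet functionals and a functional separating these two tiles all vanish on the flat.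
If some generator were killed by none of the three, a functional killing it and the flat would
attain its maximum over the zonotope strictly inside a hexagon whose vertices come from points of
the zonotope, which `planar_lt` forbids.

Given the belt condition, measure two hyperplanes `H`, `K` by the codimension `r` of the flat
spanned by the generators in `H ⊓ K`; `r ≤ 1` means equal and `r = 2` means adjacent. Choose a
codimension-two flat in `H` containing that common flat. The two other hyperplanes through it cover
the generators of `K` outside `H`, so one of them takes at least half of what is missing: one step
brings `r` down to at most `(r + 1) / 2` (`exists_halving`). This rounds badly at `r = 5`, where
`exists_middle` reaches `2` instead of `3` by a parity argument on pairings of four vectors. Hence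
`k` steps suffice when `r ≤ 5 * 2 ^ k / 4`, and `r ≤ d` gives the logarithm of `4d/5`. -/

/-- A subspace spanned by the members of `s` that it contains. -/
def IsFlat (s : Set V) (W : Submodule ℝ V) : Prop := span ℝ (s ∩ (W : Set V)) = W

/-- A flat of codimension one. -/
def IsFlatHyperplane (s : Set V) (H : Submodule ℝ V) : Prop :=
  IsFlat s H ∧ finrank ℝ H + 1 = finrank ℝ V

/-- A flat of codimension two. -/
def IsFlatCorankTwo (s : Set V) (L : Submodule ℝ V) : Prop :=
  IsFlat s L ∧ finrank ℝ L + 2 = finrank ℝ V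

/-- The flat spanned by the members of `s` in `W`. -/
def flatSpan (s : Set V) (W : Submodule ℝ V) : Submodule ℝ V := span ℝ (s ∩ (W : Set V))

/-- Every flat of codimension two is contained in at most three hyperplanes that together
cover `s`. -/
def BeltCondition (s : Set V) : Prop :=
  ∀ L : Submodule ℝ V, IsFlatCorankTwo s L → ∃ f : Fin 3 → V →ₗ[ℝ] ℝ,
    (∀ i, f i ≠ 0 ∧ L ≤ LinearMap.ker (f i)) ∧ ∀ x ∈ s, ∃ i, f i x = 0

/-- Two subspaces sharing a flat of codimension two. -/
def FlatAdj (s : Set V) (H H' : Submodule ℝ V) : Prop :=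
  ∃ L, IsFlatCorankTwo s L ∧ L ≤ H ∧ L ≤ H'

/-- `H` and `H'` are joined by a chain of `k` adjacencies between flat hyperplanes. -/
def Linked (s : Set V) : ℕ → Submodule ℝ V → Submodule ℝ V → Prop
  | 0, H, H' => H = H'
  | k + 1, H, H' => ∃ H'', IsFlatHyperplane s H'' ∧ FlatAdj s H H'' ∧ Linked s k H'' H'

variable {s : Set V}

lemma flatSpan_le (W : Submodule ℝ V) : flatSpan s W ≤ W :=
  span_le.2 Set.inter_subset_right

lemma mem_flatSpan {W : Submodule ℝ V} {x : V} (hx : x ∈ s) (hW : x ∈ W) : x ∈ flatSpan s W :=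
  subset_span ⟨hx, hW⟩

lemma isFlat_span {t : Set V} (ht : t ⊆ s) : IsFlat s (span ℝ t) :=
  le_antisymm (span_le.2 Set.inter_subset_right)
    (span_mono fun _ hx => ⟨ht hx, subset_span hx⟩)

lemma isFlat_flatSpan (W : Submodule ℝ V) : IsFlat s (flatSpan s W) :=
  isFlat_span Set.inter_subset_left

lemma IsFlat.le_flatSpan {W W' : Submodule ℝ V} (h : IsFlat s W) (hW : W ≤ W') :
    W ≤ flatSpan s W' := by
  rw [← h]
  exact span_mono (Set.inter_subset_inter_right _ hW)

lemma IsFlat.sup {W W' : Submodule ℝ V} (h : IsFlat s W) (h' : IsFlat s W') :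
    IsFlat s (W ⊔ W') := by
  have := isFlat_span (s := s)
    (Set.union_subset (Set.inter_subset_left (s := s) (t := (W : Set V)))
      (Set.inter_subset_left (s := s) (t := (W' : Set V))))
  rw [span_union] at this
  rwa [IsFlat, h, h'] at this

lemma IsFlat.exists_notMem {W L : Submodule ℝ V} (hW : IsFlat s W) (h : ¬ W ≤ L) :
    ∃ a ∈ s, a ∈ W ∧ a ∉ L := by
  by_contra! hc
  apply h
  rw [← hW]
  exact span_le.2 fun x hx => hc x hx.1 hx.2

lemma exists_linked_le_of_adj {H H' K : Submodule ℝ V} (hH' : IsFlatHyperplane s H')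
    (h : FlatAdj s H H') {k : ℕ} (hk : ∃ j ≤ k, Linked s j H' K) :
    ∃ j ≤ k + 1, Linked s j H K := by
  obtain ⟨j, hj, hl⟩ := hk
  exact ⟨j + 1, by omega, H', hH', h, hl⟩

variable [FiniteDimensional ℝ V]

lemma finrank_sup_span_image_le {ι : Type*} [Fintype ι] (L : Submodule ℝ V) (a : ι → V)
    (S : Finset ι) : finrank ℝ ↥(L ⊔ span ℝ (a '' S)) ≤ finrank ℝ L + S.card := by
  classical
  refine (finrank_add_le_finrank_add_finrank _ _).trans ?_
  gcongr
  rw [← Finset.coe_image]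
  exact (finrank_span_finset_le_card _).trans Finset.card_image_le

/-- A flat has a basis from `s` relative to any subspace of it. -/
lemma IsFlat.exists_relative_basis {W L : Submodule ℝ V} (hW : IsFlat s W) (hL : L ≤ W) {k : ℕ}
    (hk : finrank ℝ L + k = finrank ℝ W) :
    ∃ a : Fin k → V, (∀ i, a i ∈ s ∧ a i ∈ W) ∧ L ⊔ span ℝ (Set.range a) = W := by
  have hmap : span ℝ (L.mkQ '' (s ∩ W)) = W.map L.mkQ := by
    rw [span_image]
    exact congrArg (map L.mkQ) hW
  have hfin : finrank ℝ (span ℝ (L.mkQ '' (s ∩ W))) = k := by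
    rw [hmap]
    have h1 := (L.mkQ.domRestrict W).finrank_range_add_finrank_ker
    have h2 : LinearMap.range (L.mkQ.domRestrict W) = W.map L.mkQ := by
      rw [LinearMap.domRestrict, LinearMap.range_comp, range_subtype]
    have h3 : LinearMap.ker (L.mkQ.domRestrict W) = L.comap W.subtype := by
      ext x
      simp [LinearMap.domRestrict_apply]
    rw [h2, h3, (comapSubtypeEquivOfLe hL).finrank_eq] at h1
    omega
  obtain ⟨f, hf, hspan⟩ : ∃ f : Fin k → V ⧸ L, (∀ i, f i ∈ L.mkQ '' (s ∩ W)) ∧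
      span ℝ (Set.range f) = W.map L.mkQ := by
    obtain ⟨f, hf, hspan, -⟩ := exists_fun_fin_finrank_span_eq ℝ (L.mkQ '' (s ∩ (W : Set V)))
    rw [← hmap, ← hfin]
    exact ⟨f, hf, hspan⟩
  choose a ha hfa using hf
  refine ⟨a, ha, ?_⟩
  have hfa' : Set.range f = L.mkQ '' Set.range a := by
    rw [← Set.range_comp]
    exact congrArg Set.range (funext fun i => (hfa i).symm)
  rw [hfa', span_image] at hspan
  have h := congrArg (comap L.mkQ) hspan
  rwa [comap_map_mkQ, comap_map_mkQ, sup_eq_right.2 hL] at h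

/-- Rank of the span of part of a relative basis. -/
lemma finrank_sup_span_image_eq {ι : Type*} [Fintype ι] [DecidableEq ι] {W L : Submodule ℝ V}
    {a : ι → V} (ha : L ⊔ span ℝ (Set.range a) = W)
    (hk : finrank ℝ L + Fintype.card ι = finrank ℝ W) (S : Finset ι) :
    finrank ℝ ↥(L ⊔ span ℝ (a '' S)) = finrank ℝ L + S.card := by
  refine le_antisymm (finrank_sup_span_image_le L a S) ?_
  have h1 := finrank_sup_span_image_le (L ⊔ span ℝ (a '' S)) a Sᶜ
  have h2 : L ⊔ span ℝ (a '' S) ⊔ span ℝ (a '' ((Sᶜ : Finset ι) : Set ι)) = W := by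
    rw [sup_assoc, ← span_union, ← Set.image_union, ← Finset.coe_union, Finset.union_compl,
      Finset.coe_univ, Set.image_univ, ha]
  rw [h2] at h1
  have h3 := Finset.card_add_card_compl S
  omega

lemma notMem_sup_span_image {ι : Type*} [Fintype ι] [DecidableEq ι] {W L : Submodule ℝ V}
    {a : ι → V} (ha : L ⊔ span ℝ (Set.range a) = W)
    (hk : finrank ℝ L + Fintype.card ι = finrank ℝ W) {S : Finset ι} {i : ι} (hi : i ∉ S) :
    a i ∉ L ⊔ span ℝ (a '' S) := by
  intro hmem
  have h1 := finrank_sup_span_image_eq ha hk S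
  have h2 := finrank_sup_span_image_eq ha hk (insert i S)
  rw [Finset.coe_insert, Set.image_insert_eq, span_insert, sup_left_comm,
    sup_eq_right.2 (by rwa [span_singleton_le_iff_mem]), h1, Finset.card_insert_of_notMem hi] at h2
  omega

lemma eq_ker_of_le {H : Submodule ℝ V} (hH : finrank ℝ H + 1 = finrank ℝ V) {f : V →ₗ[ℝ] ℝ}
    (hf : f ≠ 0) (h : H ≤ LinearMap.ker f) : H = LinearMap.ker f := by
  have := Module.Dual.finrank_ker_add_one_of_ne_zero hf
  exact eq_of_le_of_finrank_le h (by omega)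

lemma exists_eq_ker {H : Submodule ℝ V} (hH : finrank ℝ H + 1 = finrank ℝ V) :
    ∃ f : V →ₗ[ℝ] ℝ, f ≠ 0 ∧ H = LinearMap.ker f := by
  obtain ⟨f, hf, h⟩ := H.exists_le_ker_of_lt_top (lt_top_of_finrank_lt_finrank (by omega))
  exact ⟨f, hf, eq_ker_of_le hH hf h⟩

/-- The hyperplanes in `BeltCondition` need not be flats. One generator outside `L` makes the span
of the generators in the kernel strictly larger than `L`, hence the whole kernel by dimension. -/
lemma IsFlatCorankTwo.isFlatHyperplane_ker {L : Submodule ℝ V} (hL : IsFlatCorankTwo s L)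
    {f : V →ₗ[ℝ] ℝ} (hf : f ≠ 0) (hLf : L ≤ LinearMap.ker f) {x : V} (hx : x ∈ s)
    (hxf : f x = 0) (hxL : x ∉ L) : IsFlatHyperplane s (LinearMap.ker f) := by
  have hker := Module.Dual.finrank_ker_add_one_of_ne_zero hf
  refine ⟨?_, hker⟩
  have h1 : L < flatSpan s (LinearMap.ker f) :=
    lt_of_le_of_ne (hL.1.le_flatSpan hLf)
      fun h => hxL (h ▸ mem_flatSpan hx (LinearMap.mem_ker.2 hxf))
  have h2 := finrank_lt_finrank_of_lt h1
  have h3 := hL.2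
  exact eq_of_le_of_finrank_le (S₁ := flatSpan s (LinearMap.ker f)) (flatSpan_le _) (by omega)

/-- Of the three hyperplanes through `L`, two cover the part of `s` outside a given one. -/
lemma BeltCondition.exists_pair (hs : BeltCondition s) {H L : Submodule ℝ V}
    (hH : IsFlatHyperplane s H) (hL : IsFlatCorankTwo s L) (hLH : L ≤ H) :
    ∃ f g : V →ₗ[ℝ] ℝ, f ≠ 0 ∧ g ≠ 0 ∧ L ≤ LinearMap.ker f ∧ L ≤ LinearMap.ker g ∧
      ∀ x ∈ s, x ∉ H → f x = 0 ∨ g x = 0 := by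
  obtain ⟨f, hf, hcov⟩ := hs L hL
  have hlt : ¬ H ≤ L := fun h => by
    have := finrank_mono h
    have := hH.2
    have := hL.2
    omega
  obtain ⟨a, has, haH, haL⟩ := hH.1.exists_notMem hlt
  obtain ⟨i, hi⟩ := hcov a has
  -- The covering hyperplane through a generator `a` of `H` outside `L` meets `H` in more than `L`,
  -- so it is `H` itself and covers nothing outside `H`.
  have hker : ∀ x, f i x = 0 → x ∈ H := by
    have h1 := (hL.isFlatHyperplane_ker (hf i).1 (hf i).2 has hi haL).2
    have h2 : L < H ⊓ LinearMap.ker (f i) :=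
      lt_of_le_of_ne (le_inf hLH (hf i).2)
        fun h => haL (h ▸ mem_inf.2 ⟨haH, LinearMap.mem_ker.2 hi⟩)
    have h3 := finrank_lt_finrank_of_lt h2
    have h4 := hL.2
    have h5 : H ⊓ LinearMap.ker (f i) = LinearMap.ker (f i) :=
      eq_of_le_of_finrank_le inf_le_right (by omega)
    intro x hx
    exact inf_eq_right.1 h5 (LinearMap.mem_ker.2 hx)
  obtain ⟨j, k, hjk⟩ : ∃ j k : Fin 3, ∀ l, l ≠ i → l = j ∨ l = k :=
    (by decide : ∀ i : Fin 3, ∃ j k : Fin 3, ∀ l, l ≠ i → l = j ∨ l = k) i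
  refine ⟨f j, f k, (hf j).1, (hf k).1, (hf j).2, (hf k).2, fun x hx hxH => ?_⟩
  obtain ⟨l, hl⟩ := hcov x hx
  rcases hjk l (fun h => hxH (hker x (h ▸ hl))) with rfl | rfl
  exacts [Or.inl hl, Or.inr hl]

/-- A step that halves the codimension of the flat spanned by the common part of two
hyperplanes. -/
lemma BeltCondition.exists_halving (hs : BeltCondition s) {H K : Submodule ℝ V}
    (hH : IsFlatHyperplane s H) (hK : IsFlatHyperplane s K)
    (hr : finrank ℝ (flatSpan s (H ⊓ K)) + 2 ≤ finrank ℝ V) :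
    ∃ H', IsFlatHyperplane s H' ∧ FlatAdj s H H' ∧
      finrank ℝ V + finrank ℝ (flatSpan s (H ⊓ K)) ≤
        2 * finrank ℝ (flatSpan s (H' ⊓ K)) + 1 := by
  classical
  set L₀ := flatSpan s (H ⊓ K) with hL₀
  have hL₀H : L₀ ≤ H := (flatSpan_le _).trans inf_le_left
  have hd1 := hH.2
  have hd2 := hK.2
  obtain ⟨k, hk⟩ : ∃ k, finrank ℝ L₀ + (k + 1) = finrank ℝ H :=
    ⟨finrank ℝ H - finrank ℝ L₀ - 1, by omega⟩
  obtain ⟨a, ha, hspan⟩ := hH.1.exists_relative_basis hL₀H hk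
  set L := L₀ ⊔ span ℝ (a '' (({0}ᶜ : Finset (Fin (k + 1))) : Set (Fin (k + 1)))) with hLdef
  have hLr : finrank ℝ L = finrank ℝ L₀ + k := by
    rw [hLdef, finrank_sup_span_image_eq hspan (by simpa using hk), Finset.card_compl]
    simp
  have hL : IsFlatCorankTwo s L := by
    refine ⟨(isFlat_flatSpan _).sup (isFlat_span ?_), by omega⟩
    rintro _ ⟨i, -, rfl⟩
    exact (ha i).1
  have hLH : L ≤ H := by
    rw [hLdef, ← hspan]
    exact sup_le_sup_left (span_mono (Set.image_subset_range _ _)) _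
  obtain ⟨f, g, hf, hg, hLf, hLg, hcov⟩ := hs.exists_pair hH hL hLH
  wlog hfg : finrank ℝ (flatSpan s (LinearMap.ker g ⊓ K)) ≤
      finrank ℝ (flatSpan s (LinearMap.ker f ⊓ K)) generalizing f g
  · exact this g f hg hf hLg hLf (fun x hx hxH => (hcov x hx hxH).symm) (le_of_not_ge hfg)
  set A := flatSpan s (LinearMap.ker f ⊓ K) with hA
  set B := flatSpan s (LinearMap.ker g ⊓ K) with hB
  have hL₀K : L₀ ≤ K := (flatSpan_le _).trans inf_le_right
  have hL₀L : L₀ ≤ L := le_sup_left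
  have hinf : L₀ ≤ A ⊓ B :=
    le_inf ((isFlat_flatSpan _).le_flatSpan (le_inf (hL₀L.trans hLf) hL₀K))
      ((isFlat_flatSpan _).le_flatSpan (le_inf (hL₀L.trans hLg) hL₀K))
  -- `A` and `B` together fill `K` and both contain `L₀`, so their ranks add up to at least `rank K
  -- + rank L₀`; the larger one gets half.
  have hsup : K ≤ A ⊔ B := by
    rw [← hK.1]
    refine span_le.2 fun x hx => ?_
    by_cases hxH : x ∈ H
    · exact mem_sup_left ((hinf.trans inf_le_left) (mem_flatSpan hx.1 ⟨hxH, hx.2⟩))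
    · rcases hcov x hx.1 hxH with h | h
      · exact mem_sup_left (mem_flatSpan hx.1 ⟨h, hx.2⟩)
      · exact mem_sup_right (mem_flatSpan hx.1 ⟨h, hx.2⟩)
  have h1 := finrank_sup_add_finrank_inf_eq A B
  have h2 := finrank_mono hinf
  have h3 := finrank_mono hsup
  -- Otherwise `A` would lie in `H ⊓ K`, hence in `L₀`, which is too small. A generator in `A`
  -- outside `L` then shows that `ker f` is a flat.
  have hAL : ¬ A ≤ L := by
    intro h
    have : A ≤ L₀ := (isFlat_flatSpan _).le_flatSpan
      (le_inf (h.trans hLH) ((flatSpan_le _).trans inf_le_right))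
    have := finrank_mono this
    omega
  obtain ⟨x, hxs, hxA, hxL⟩ := (isFlat_flatSpan (s := s) _).exists_notMem hAL
  have hxf : f x = 0 := (mem_inf.1 (flatSpan_le _ hxA)).1
  refine ⟨LinearMap.ker f, hL.isFlatHyperplane_ker hf hLf hxs hxf hxL, ⟨L, hL, hLH, hLf⟩, ?_⟩
  have h4 : finrank ℝ V + finrank ℝ L₀ ≤ 2 * finrank ℝ A + 1 := by omega
  exact h4

/-- Two sets of at most two points each that cover four points pair them up. -/
lemma pairing_of_union_eq_univ : ∀ A B : Finset (Fin 4), A ∪ B = Finset.univ → A.card ≤ 2 →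
    B.card ≤ 2 → ∃ C D : Finset (Fin 4), ((C = A ∧ D = B) ∨ (C = B ∧ D = A)) ∧
      ((C = {0, 1} ∧ D = {2, 3}) ∨ (C = {0, 2} ∧ D = {1, 3}) ∨ (C = {0, 3} ∧ D = {1, 2})) := by
  decide

/-- Four indices share three values, so some value is taken at most once. -/
lemma exists_rare_value :
    ∀ t : Fin 4 → Fin 3, ∃ (τ : Fin 3) (i₀ : Fin 4), ∀ i, i ≠ i₀ → τ ≠ t i := by
  decide

/-- In relative rank five two hyperplanes have a common neighbour. -/
lemma BeltCondition.exists_middle (hs : BeltCondition s) {H K : Submodule ℝ V}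
    (hH : IsFlatHyperplane s H) (hK : IsFlatHyperplane s K)
    (hr : finrank ℝ (flatSpan s (H ⊓ K)) + 5 = finrank ℝ V) :
    ∃ H', IsFlatHyperplane s H' ∧ FlatAdj s H H' ∧
      finrank ℝ V ≤ finrank ℝ (flatSpan s (H' ⊓ K)) + 2 := by
  classical
  by_contra hno
  set L₀ := flatSpan s (H ⊓ K) with hL₀
  have hL₀H : L₀ ≤ H := (flatSpan_le _).trans inf_le_left
  have hL₀K : L₀ ≤ K := (flatSpan_le _).trans inf_le_right
  have hd1 := hH.2
  have hd2 := hK.2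
  obtain ⟨a, ha, hspana⟩ := hH.1.exists_relative_basis hL₀H (k := 4) (by omega)
  obtain ⟨b, hb, hspanb⟩ := hK.1.exists_relative_basis hL₀K (k := 4) (by omega)
  have hka : finrank ℝ L₀ + Fintype.card (Fin 4) = finrank ℝ H := by
    rw [Fintype.card_fin]
    omega
  have hkb : finrank ℝ L₀ + Fintype.card (Fin 4) = finrank ℝ K := by
    rw [Fintype.card_fin]
    omega
  obtain ⟨ψ, hψ0, hψ⟩ := exists_eq_ker hd1
  have hbL₀ : ∀ j, b j ∉ L₀ := fun j hj =>
    notMem_sup_span_image hspanb hkb (Finset.notMem_empty j) (mem_sup_left hj)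
  have haL₀ : ∀ j, a j ∉ L₀ := fun j hj =>
    notMem_sup_span_image hspana hka (Finset.notMem_empty j) (mem_sup_left hj)
  have hbH : ∀ j, b j ∉ H := fun j hj => hbL₀ j (mem_flatSpan (hb j).1 ⟨hj, (hb j).2⟩)
  have haK : ∀ j, a j ∉ K := fun j hj => haL₀ j (mem_flatSpan (ha j).1 ⟨(ha j).2, hj⟩)
  have hψb : ∀ j, ψ (b j) ≠ 0 := fun j hj => hbH j (hψ ▸ LinearMap.mem_ker.2 hj)
  -- The `b j` are scaled to the affine hyperplane `ψ = 1`, so that their differences lie in `H`.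
  set c : Fin 4 → V := fun j => (ψ (b j))⁻¹ • b j with hc
  have hψc : ∀ j, ψ (c j) = 1 := fun j => by simp [hc, hψb j]
  have hcH : ∀ j k, c j - c k ∈ H := fun j k => by
    rw [hψ, LinearMap.mem_ker, map_sub, hψc, hψc, sub_self]
  have hcK : ∀ j, c j ∈ K := fun j => smul_mem _ _ (hb j).2
  set L : Fin 4 → Submodule ℝ V := fun i =>
    L₀ ⊔ span ℝ (a '' (({i}ᶜ : Finset (Fin 4)) : Set (Fin 4))) with hLdef
  have haL : ∀ i, a i ∉ L i := fun i => notMem_sup_span_image hspana hka (by simp)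
  have hLr : ∀ i, finrank ℝ (L i) = finrank ℝ L₀ + 3 := fun i => by
    rw [hLdef, finrank_sup_span_image_eq hspana hka, Finset.card_compl]
    simp
  have hL : ∀ i, IsFlatCorankTwo s (L i) := fun i => by
    refine ⟨(isFlat_flatSpan _).sup (isFlat_span ?_), by rw [hLr]; omega⟩
    rintro _ ⟨i, -, rfl⟩
    exact (ha i).1
  have hLH : ∀ i, L i ≤ H := fun i => by
    rw [← hspana]
    exact sup_le_sup_left (span_mono (Set.image_subset_range _ _)) _
  -- Three of the `b j` in `ker f` would span with `L₀` a flat of codimension two inside `K`, making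
  -- `ker f` the excluded middle hyperplane.
  have hfew : ∀ i (f : V →ₗ[ℝ] ℝ), f ≠ 0 → L i ≤ LinearMap.ker f →
      (Finset.univ.filter fun j => f (b j) = 0).card ≤ 2 := by
    intro i f hf hLf
    by_contra! hcard
    obtain ⟨j, hj⟩ := Finset.card_pos.1 (by omega :
      0 < (Finset.univ.filter fun j => f (b j) = 0).card)
    refine hno ⟨LinearMap.ker f, (hL i).isFlatHyperplane_ker hf hLf (hb j).1
      (Finset.mem_filter.1 hj).2 (fun h => hbH j (hLH i h)), ⟨L i, hL i, hLH i, hLf⟩, ?_⟩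
    have h1 := finrank_sup_span_image_eq hspanb hkb (Finset.univ.filter fun j => f (b j) = 0)
    have h2 : L₀ ⊔ span ℝ (b '' ((Finset.univ.filter fun j => f (b j) = 0 : Finset (Fin 4)) :
        Set (Fin 4))) ≤ flatSpan s (LinearMap.ker f ⊓ K) := by
      refine sup_le ((isFlat_flatSpan _).le_flatSpan
        (le_inf (le_sup_left.trans hLf) hL₀K)) (span_le.2 ?_)
      rintro _ ⟨j, hj, rfl⟩
      exact mem_flatSpan (hb j).1 ⟨(Finset.mem_filter.1 hj).2, (hb j).2⟩
    have h3 := finrank_mono h2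
    omega
  -- `L i` is exactly `H ⊓ ker f`, and the difference of two `c j` lying in `ker f` belongs to both.
  have hpair : ∀ i (f : V →ₗ[ℝ] ℝ), L i ≤ LinearMap.ker f → ∀ j k, f (b j) = 0 →
      f (b k) = 0 → f ≠ 0 → c j - c k ∈ L i := by
    intro i f hLf j k hj hk hf
    have hker := Module.Dual.finrank_ker_add_one_of_ne_zero hf
    have hlt : H ⊓ LinearMap.ker f < H := by
      refine lt_of_le_of_ne inf_le_left fun h => hbH j ?_
      rw [eq_ker_of_le hd1 hf (inf_eq_left.1 h)]
      exact hj
    have h1 := finrank_lt_finrank_of_lt hlt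
    have h2 : L i = H ⊓ LinearMap.ker f :=
      eq_of_le_of_finrank_le (le_inf (hLH i) hLf) (by have := hLr i; omega)
    rw [h2]
    refine ⟨hcH j k, ?_⟩
    simp [hc, hj, hk]
  -- One signed sum per pairing of the four indices. When the hyperplanes through `L i` induce
  -- pairing `t`, the two differences inside its pairs lie in `L i`, and their sum and difference
  -- are the two vectors `u τ` with `τ ≠ t`.
  set u : Fin 3 → V := ![c 0 + c 1 - c 2 - c 3, c 0 + c 2 - c 1 - c 3, c 0 + c 3 - c 1 - c 2]
    with hu
  have htype : ∀ i, ∃ t : Fin 3, ∀ τ, τ ≠ t → u τ ∈ L i := by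
    intro i
    obtain ⟨f, g, hf, hg, hLf, hLg, hcov⟩ := hs.exists_pair hH (hL i) (hLH i)
    obtain ⟨C, D, hCD, hcases⟩ := pairing_of_union_eq_univ
      (Finset.univ.filter fun j => f (b j) = 0) (Finset.univ.filter fun j => g (b j) = 0)
      (by
        ext j
        simpa using hcov (b j) (hb j).1 (hbH j))
      (hfew i f hf hLf) (hfew i g hg hLg)
    have hCD' : (∀ j ∈ C, ∀ k ∈ C, c j - c k ∈ L i) ∧ ∀ j ∈ D, ∀ k ∈ D, c j - c k ∈ L i := by
      have hF : ∀ j ∈ Finset.univ.filter (fun j => f (b j) = 0),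
          ∀ k ∈ Finset.univ.filter (fun j => f (b j) = 0), c j - c k ∈ L i := fun j hj k hk =>
        hpair i f hLf j k (Finset.mem_filter.1 hj).2 (Finset.mem_filter.1 hk).2 hf
      have hG : ∀ j ∈ Finset.univ.filter (fun j => g (b j) = 0),
          ∀ k ∈ Finset.univ.filter (fun j => g (b j) = 0), c j - c k ∈ L i := fun j hj k hk =>
        hpair i g hLg j k (Finset.mem_filter.1 hj).2 (Finset.mem_filter.1 hk).2 hg
      rcases hCD with ⟨rfl, rfl⟩ | ⟨rfl, rfl⟩
      exacts [⟨hF, hG⟩, ⟨hG, hF⟩]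
    obtain ⟨hC, hD⟩ := hCD'
    rcases hcases with ⟨rfl, rfl⟩ | ⟨rfl, rfl⟩ | ⟨rfl, rfl⟩
    · have h1 := hC 0 (by simp) 1 (by simp)
      have h2 := hD 2 (by simp) 3 (by simp)
      refine ⟨0, fun τ hτ => ?_⟩
      fin_cases τ
      · exact absurd rfl hτ
      · have := add_mem h1 h2
        simp only [hu]
        convert this using 1
        simp
        abel
      · have := sub_mem h1 h2
        simp only [hu]
        convert this using 1
        simp
        abel
    · have h1 := hC 0 (by simp) 2 (by simp)
      have h2 := hD 1 (by simp) 3 (by simp)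
      refine ⟨1, fun τ hτ => ?_⟩
      fin_cases τ
      · have := add_mem h1 h2
        simp only [hu]
        convert this using 1
        simp
        abel
      · exact absurd rfl hτ
      · have := sub_mem h1 h2
        simp only [hu]
        convert this using 1
        simp
        abel
    · have h1 := hC 0 (by simp) 3 (by simp)
      have h2 := hD 1 (by simp) 2 (by simp)
      refine ⟨2, fun τ hτ => ?_⟩
      fin_cases τ
      · have := add_mem h1 h2
        simp only [hu]
        convert this using 1
        simp
        abel
      · have := sub_mem h1 h2
        simp only [hu]
        convert this using 1
        simp
        abel
      · exact absurd rfl hτ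
  choose t ht using htype
  obtain ⟨τ, i₀, hτ⟩ := exists_rare_value t
  have huL : ∀ i, i ≠ i₀ → u τ ∈ L i := fun i hi => ht i τ (hτ i hi)
  have huH : u τ ∈ H := by
    obtain ⟨i, hi⟩ := exists_ne i₀
    exact hLH i (huL i hi)
  have huK : u τ ∈ K := by
    fin_cases τ
    exacts [sub_mem (sub_mem (add_mem (hcK 0) (hcK 1)) (hcK 2)) (hcK 3),
      sub_mem (sub_mem (add_mem (hcK 0) (hcK 2)) (hcK 1)) (hcK 3),
      sub_mem (sub_mem (add_mem (hcK 0) (hcK 3)) (hcK 1)) (hcK 2)]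
  -- Membership in three of the `L i` leaves, modulo `L₀`, only a multiple of `a i₀`; this multiple
  -- vanishes because `u τ` lies in `K` and `a i₀` does not.
  have huL₀ : u τ ∈ L₀ := by
    rw [← hspana] at huH
    obtain ⟨l, hl, y, hy, hly⟩ := mem_sup.1 huH
    obtain ⟨e, rfl⟩ := (mem_span_range_iff_exists_fun ℝ).1 hy
    have hea : ∀ i, e i • a i ∈ L i → e i = 0 := fun i hi => by
      by_contra h
      exact haL i ((smul_mem_iff _ h).1 hi)
    have hrest : ∀ i, ∑ k ∈ {i}ᶜ, e k • a k ∈ L i := fun i =>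
      sum_mem fun k hk => smul_mem _ _
        (mem_sup_right (subset_span (Set.mem_image_of_mem a (Finset.mem_coe.2 hk))))
    have he : ∀ i, i ≠ i₀ → e i = 0 := fun i hi => by
      apply hea
      have h1 : e i • a i = u τ - l - ∑ k ∈ {i}ᶜ, e k • a k := by
        rw [← hly, Fintype.sum_eq_add_sum_compl i]
        abel
      rw [h1]
      exact sub_mem (sub_mem (huL i hi) (mem_sup_left hl)) (hrest i)
    have hsum : ∑ i, e i • a i = e i₀ • a i₀ :=
      Fintype.sum_eq_single _ fun i hi => by rw [he i hi, zero_smul]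
    rw [hsum] at hly
    have h0 : e i₀ = 0 := by
      by_contra h
      refine haK i₀ ((smul_mem_iff _ h).1 ?_)
      rw [← add_sub_cancel_left l (e i₀ • a i₀), hly]
      exact sub_mem huK (hL₀K hl)
    rw [← hly, h0, zero_smul, add_zero]
    exact hl
  -- The relation `u τ ∈ L₀` expresses `c 0` through the other `c j`, against the independence of
  -- the `b j` modulo `L₀`.
  have hc0 : c 0 ∈ L₀ ⊔ span ℝ (b '' (({0}ᶜ : Finset (Fin 4)) : Set (Fin 4))) := by
    have hcj : ∀ j, j ≠ 0 → c j ∈ L₀ ⊔ span ℝ (b '' (({0}ᶜ : Finset (Fin 4)) : Set (Fin 4))) :=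
      fun j hj => smul_mem _ _ (mem_sup_right (subset_span ⟨j, by simpa using hj, rfl⟩))
    have h1 := hcj 1 (by decide)
    have h2 := hcj 2 (by decide)
    have h3 := hcj 3 (by decide)
    have h0 : u τ ∈ L₀ ⊔ span ℝ (b '' (({0}ᶜ : Finset (Fin 4)) : Set (Fin 4))) :=
      mem_sup_left huL₀
    fin_cases τ
    · have := add_mem (sub_mem h0 h1) (add_mem h2 h3)
      convert this using 1
      simp [hu]
      abel
    · have := add_mem (sub_mem h0 h2) (add_mem h1 h3)
      convert this using 1
      simp [hu]
      abel
    · have := add_mem (sub_mem h0 h3) (add_mem h1 h2)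
      convert this using 1
      simp [hu]
      abel
  exact notMem_sup_span_image hspanb hkb (S := {0}ᶜ) (i := 0) (by simp)
    ((smul_mem_iff _ (inv_ne_zero (hψb 0))).1 hc0)

/-- Logarithmic bound for the distance between two flat hyperplanes. -/
theorem BeltCondition.exists_linked_le (hs : BeltCondition s) (k : ℕ) {H K : Submodule ℝ V}
    (hH : IsFlatHyperplane s H) (hK : IsFlatHyperplane s K)
    (hk : 4 * finrank ℝ V ≤ 4 * finrank ℝ (flatSpan s (H ⊓ K)) + 5 * 2 ^ k) :
    ∃ j ≤ k, Linked s j H K := by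
  have hone : ∀ {H : Submodule ℝ V}, IsFlatHyperplane s H →
      finrank ℝ V ≤ finrank ℝ (flatSpan s (H ⊓ K)) + 1 → H = K := by
    intro H hH h
    have h1 : H ⊓ K = H := eq_of_le_of_finrank_le inf_le_left (by
      have := finrank_mono (flatSpan_le (s := s) (H ⊓ K))
      have := hH.2
      omega)
    have h2 : H ⊓ K = K := eq_of_le_of_finrank_le inf_le_right (by
      have := finrank_mono (flatSpan_le (s := s) (H ⊓ K))
      have := hK.2
      omega)
    exact h1.symm.trans h2
  have htwo : ∀ {H : Submodule ℝ V}, IsFlatHyperplane s H →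
      finrank ℝ V ≤ finrank ℝ (flatSpan s (H ⊓ K)) + 2 → ∃ j ≤ 1, Linked s j H K := by
    intro H hH h
    rcases h.lt_or_eq with h | h
    · exact ⟨0, by omega, hone hH (by omega)⟩
    · exact ⟨1, le_rfl, K, hK, ⟨_, ⟨isFlat_flatSpan _, h.symm⟩,
        (flatSpan_le _).trans inf_le_left, (flatSpan_le _).trans inf_le_right⟩, rfl⟩
  induction k generalizing H with
  | zero => exact ⟨0, le_rfl, hone hH (by omega)⟩
  | succ k ih =>
    by_cases h2 : finrank ℝ V ≤ finrank ℝ (flatSpan s (H ⊓ K)) + 2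
    · obtain ⟨j, hj, h⟩ := htwo hH h2
      exact ⟨j, by omega, h⟩
    -- With two steps allowed the codimension is 3, 4 or 5: halving sends 3 and 4 to 2, while 5
    -- needs `exists_middle`. With more steps the bound `5 * 2 ^ k / 4` is an even integer, and
    -- halving loses nothing to rounding.
    rcases k with _ | _ | k
    · omega
    · by_cases h5 : finrank ℝ (flatSpan s (H ⊓ K)) + 5 = finrank ℝ V
      · obtain ⟨H', hH', hadj, hr⟩ := hs.exists_middle hH hK h5
        exact exists_linked_le_of_adj hH' hadj (htwo hH' hr)
      · obtain ⟨H', hH', hadj, hr⟩ := hs.exists_halving hH hK (by omega)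
        exact exists_linked_le_of_adj hH' hadj (htwo hH' (by omega))
    · obtain ⟨H', hH', hadj, hr⟩ := hs.exists_halving hH hK (by omega)
      refine exists_linked_le_of_adj hH' hadj (ih hH' ?_)
      rw [pow_succ, pow_succ] at hk ⊢
      rw [pow_succ] at hk
      omega

end Flats

/-! ### Faces of zonotopes and the translation of belt paths into chains of flats. -/

section Zono

open Module Submodule

variable {E : Type*} [NormedAddCommGroup E] [NormedSpace ℝ E] {ι : Type*} [Fintype ι]

/-- The zonotope centred at the origin with generators `u i`. -/
def zono (u : ι → E) : Set E := {x | ∃ μ : ι → ℝ, (∀ i, |μ i| ≤ 1) ∧ x = ∑ i, μ i • u i}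

/-- The support function of `zono u`. -/
def zonoSupp (u : ι → E) (f : E →ₗ[ℝ] ℝ) : ℝ := ∑ i, |f (u i)|

/-- A point of `zono u` at which `f` is maximal. -/
noncomputable def zonoMax (u : ι → E) (f : E →ₗ[ℝ] ℝ) : E :=
  ∑ i, (SignType.sign (f (u i)) : ℝ) • u i

lemma IsZonotope.exists_eq_vadd_zono {P : Set E} (hP : IsZonotope P) :
    ∃ (n : ℕ) (u : Fin n → E) (z : E), P = z +ᵥ zono u := by
  obtain ⟨n, v, c, rfl⟩ := hP
  refine ⟨n, fun i => (1 / 2 : ℝ) • v i, c + ∑ i, (1 / 2 : ℝ) • v i, ?_⟩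
  rw [← vadd_vadd]
  congr 1
  ext x
  rw [Set.mem_fintype_sum, Set.mem_vadd_set]
  constructor
  · rintro ⟨g, hg, rfl⟩
    simp only [segment_eq_image, Set.mem_image, smul_zero, zero_add] at hg
    choose θ hθ hθg using hg
    refine ⟨∑ i, (2 * θ i - 1) • (1 / 2 : ℝ) • v i, ⟨fun i => 2 * θ i - 1, fun i => ?_, rfl⟩, ?_⟩
    · have := hθ i
      rw [abs_le]
      constructor <;> linarith [this.1, this.2]
    · rw [vadd_eq_add, ← Finset.sum_add_distrib]
      refine Finset.sum_congr rfl fun i _ => ?_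
      rw [← hθg i, smul_smul, ← add_smul]
      congr 1
      ring
  · rintro ⟨_, ⟨μ, hμ, rfl⟩, rfl⟩
    refine ⟨fun i => ((μ i + 1) / 2) • v i, fun i => ?_, ?_⟩
    · rw [segment_eq_image]
      have := abs_le.1 (hμ i)
      exact ⟨(μ i + 1) / 2, ⟨by linarith [this.1], by linarith [this.2]⟩, by simp⟩
    · rw [vadd_eq_add, ← Finset.sum_add_distrib]
      refine Finset.sum_congr rfl fun i _ => ?_
      rw [smul_smul, ← add_smul]
      ring_nf

variable {u : ι → E}

lemma neg_mem_zono {x : E} (hx : x ∈ zono u) : -x ∈ zono u := by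
  obtain ⟨μ, hμ, rfl⟩ := hx
  exact ⟨fun i => -μ i, fun i => by simpa using hμ i, by simp⟩

lemma neg_mem_zono_iff {x : E} : -x ∈ zono u ↔ x ∈ zono u :=
  ⟨fun h => by simpa using neg_mem_zono h, neg_mem_zono⟩

lemma zono_eq_image : zono u =
    Fintype.linearCombination ℝ u '' Set.pi Set.univ fun _ => Set.Icc (-1 : ℝ) 1 := by
  ext x
  simp only [zono, Set.mem_ofPred_eq, Set.mem_image, Set.mem_univ_pi, Set.mem_Icc, abs_le,
    Fintype.linearCombination_apply, eq_comm]

lemma convex_zono : Convex ℝ (zono u) := by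
  rw [zono_eq_image]
  exact (convex_pi fun _ _ => convex_Icc _ _).linear_image _

lemma isCompact_zono : IsCompact (zono u) := by
  rw [zono_eq_image]
  exact (isCompact_univ_pi fun _ => isCompact_Icc).image
    (LinearMap.continuous_on_pi _)

lemma abs_apply_le_zonoSupp (f : E →ₗ[ℝ] ℝ) {x : E} (hx : x ∈ zono u) :
    |f x| ≤ zonoSupp u f := by
  obtain ⟨μ, hμ, rfl⟩ := hx
  rw [map_sum]
  refine (Finset.abs_sum_le_sum_abs _ _).trans (Finset.sum_le_sum fun i _ => ?_)
  rw [map_smul, smul_eq_mul, abs_mul]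
  exact mul_le_of_le_one_left (abs_nonneg _) (hμ i)

lemma apply_le_zonoSupp (f : E →ₗ[ℝ] ℝ) {x : E} (hx : x ∈ zono u) : f x ≤ zonoSupp u f :=
  (le_abs_self _).trans (abs_apply_le_zonoSupp f hx)

lemma abs_sign_le_one (r : ℝ) : |(SignType.sign r : ℝ)| ≤ 1 := by
  rcases lt_trichotomy r 0 with h | h | h <;> simp [h]

lemma zonoMax_mem (f : E →ₗ[ℝ] ℝ) : zonoMax u f ∈ zono u :=
  ⟨_, fun _ => abs_sign_le_one _, rfl⟩

lemma apply_zonoMax (f : E →ₗ[ℝ] ℝ) : f (zonoMax u f) = zonoSupp u f := by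
  rw [zonoMax, zonoSupp, map_sum]
  refine Finset.sum_congr rfl fun i _ => ?_
  rw [map_smul, smul_eq_mul, sign_mul_self]

/-- Equality in a sum of termwise inequalities: at a maximiser of `f` the coefficient of every
generator not killed by `f` is forced. -/
lemma mul_apply_eq_abs {f : E →ₗ[ℝ] ℝ} {μ : ι → ℝ} (hμ : ∀ i, |μ i| ≤ 1)
    (h : f (∑ i, μ i • u i) = zonoSupp u f) (i : ι) : μ i * f (u i) = |f (u i)| := by
  have hle : ∀ i ∈ Finset.univ, μ i * f (u i) ≤ |f (u i)| := fun i _ => by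
    refine (le_abs_self _).trans ?_
    rw [abs_mul]
    exact mul_le_of_le_one_left (abs_nonneg _) (hμ i)
  rw [map_sum, zonoSupp] at h
  simp only [map_smul, smul_eq_mul] at h
  exact (Finset.sum_eq_sum_iff_of_le hle).1 h i (Finset.mem_univ i)

lemma apply_eq_zonoSupp_iff {f : E →ₗ[ℝ] ℝ} {x : E} :
    (∀ y ∈ zono u, f y ≤ f x) ∧ x ∈ zono u ↔ x ∈ zono u ∧ f x = zonoSupp u f :=
  ⟨fun h => ⟨h.2, le_antisymm (apply_le_zonoSupp f h.2)
    (apply_zonoMax (u := u) f ▸ h.1 _ (zonoMax_mem f))⟩,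
    fun h => ⟨fun _ hy => h.2 ▸ apply_le_zonoSupp f hy, h.1⟩⟩

lemma span_range_eq_top_of_interior_zono (h : (interior (zono u)).Nonempty) :
    span ℝ (Set.range u) = ⊤ := by
  have hle : zono u ⊆ span ℝ (Set.range u) := by
    rintro _ ⟨μ, -, rfl⟩
    exact sum_mem fun i _ => smul_mem _ _ (subset_span ⟨i, rfl⟩)
  exact eq_top_of_nonempty_interior' _ (h.mono (interior_mono hle))

/-- The face of `z +ᵥ zono u` in the direction `f`. -/
def zonoFace (u : ι → E) (z : E) (f : E →ₗ[ℝ] ℝ) : Set E :=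
  {x | x - z ∈ zono u ∧ f (x - z) = zonoSupp u f}

lemma mem_vadd_zono {x z : E} : x ∈ z +ᵥ zono u ↔ x - z ∈ zono u := by
  rw [Set.mem_vadd_set_iff_neg_vadd_mem, vadd_eq_add, neg_add_eq_sub]

lemma zonoFace_eq (z : E) (f : E →ₗ[ℝ] ℝ) : zonoFace u z f =
    {x | x ∈ z +ᵥ zono u ∧ ∀ y ∈ z +ᵥ zono u, f y ≤ f x} := by
  ext x
  rw [zonoFace, Set.mem_ofPred_eq, ← apply_eq_zonoSupp_iff, Set.mem_ofPred_eq, mem_vadd_zono,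
    and_comm]
  refine and_congr_right fun _ => ⟨fun h y hy => ?_, fun h y hy => ?_⟩
  · have := h (y - z) (mem_vadd_zono.1 hy)
    rw [map_sub, map_sub] at this
    linarith
  · have := h (y + z) (mem_vadd_zono.2 (by simpa using hy))
    rw [map_add] at this
    rw [map_sub]
    linarith

lemma zonoMax_add_mem_zonoFace (z : E) (f : E →ₗ[ℝ] ℝ) : zonoMax u f + z ∈ zonoFace u z f := by
  rw [zonoFace, Set.mem_ofPred_eq, add_sub_cancel_right]
  exact ⟨zonoMax_mem f, apply_zonoMax f⟩

lemma zonoMax_add_smul_mem {f : E →ₗ[ℝ] ℝ} {i : ι} (hi : f (u i) = 0) {c : ℝ} (hc : |c| ≤ 1) :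
    zonoMax u f + c • u i ∈ zono u := by
  classical
  refine ⟨fun j => SignType.sign (f (u j)) + if j = i then c else 0, fun j => ?_, ?_⟩
  · by_cases hj : j = i
    · simpa [hj, hi] using hc
    · simpa [hj] using abs_sign_le_one _
  · simp only [add_smul, Finset.sum_add_distrib, ite_smul, zero_smul, Finset.sum_ite_eq',
      Finset.mem_univ, if_true, zonoMax]

/-- On the face, coefficients off `ker f` are forced and those on `ker f` are free. -/
lemma vectorSpan_zonoFace (z : E) (f : E →ₗ[ℝ] ℝ) :
    vectorSpan ℝ (zonoFace u z f) = flatSpan (Set.range u) (LinearMap.ker f) := by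
  apply le_antisymm
  · rw [vectorSpan_def, span_le]
    rintro _ ⟨x, ⟨⟨μ, hμ, hx⟩, hfx⟩, y, ⟨⟨ν, hν, hy⟩, hfy⟩, rfl⟩
    rw [hx] at hfx
    rw [hy] at hfy
    have hxy : x -ᵥ y = ∑ i, (μ i - ν i) • u i := by
      rw [vsub_eq_sub, ← sub_sub_sub_cancel_right x y z, hx, hy, ← Finset.sum_sub_distrib]
      simp only [sub_smul]
    change x -ᵥ y ∈ _
    rw [hxy]
    refine sum_mem fun i _ => ?_
    by_cases hi : f (u i) = 0
    · exact smul_mem _ _ (mem_flatSpan ⟨i, rfl⟩ hi)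
    · have h1 := mul_apply_eq_abs hμ hfx i
      have h2 := mul_apply_eq_abs hν hfy i
      rw [mul_right_cancel₀ hi (h1.trans h2.symm), sub_self, zero_smul]
      exact zero_mem _
  · rw [flatSpan, span_le]
    rintro _ ⟨⟨i, rfl⟩, hi⟩
    have hi : f (u i) = 0 := hi
    have hmem : zonoMax u f + z + u i ∈ zonoFace u z f := by
      rw [zonoFace, Set.mem_ofPred_eq, add_right_comm, add_sub_cancel_right]
      refine ⟨by simpa using zonoMax_add_smul_mem hi (c := 1) (by simp), ?_⟩
      rw [map_add, hi, add_zero, apply_zonoMax]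
    have := vsub_mem_vectorSpan ℝ hmem (zonoMax_add_mem_zonoFace z f)
    simpa using this

lemma IsFace.exists_eq_zonoFace {z : E} {F : Set E} (h : IsFace (z +ᵥ zono u) F) :
    ∃ f : E →ₗ[ℝ] ℝ, F = zonoFace u z f := by
  obtain ⟨l, hl⟩ := h.1 h.2
  exact ⟨l, hl.trans (zonoFace_eq z (l : E →ₗ[ℝ] ℝ)).symm⟩

lemma dim_vadd_zono (z : E) (h : (interior (zono u)).Nonempty) :
    dim (z +ᵥ zono u) = finrank ℝ E := by
  have hspan := span_range_eq_top_of_interior_zono h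
  have h0 : z +ᵥ zono u = zonoFace u z 0 := by
    ext x
    simp [mem_vadd_zono, zonoFace, zonoSupp]
  rw [dim, h0, vectorSpan_zonoFace, LinearMap.ker_zero, flatSpan, top_coe, Set.inter_univ, hspan,
    finrank_top]

lemma zonoFace_smul_of_pos (z : E) (f : E →ₗ[ℝ] ℝ) {c : ℝ} (hc : 0 < c) :
    zonoFace u z (c • f) = zonoFace u z f := by
  ext x
  simp [zonoFace, zonoSupp, abs_mul, ← Finset.mul_sum, abs_of_pos hc, hc.ne']

lemma pointReflection_mem_vadd_zono {x z : E} :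
    AffineEquiv.pointReflection ℝ z x ∈ z +ᵥ zono u ↔ x ∈ z +ᵥ zono u := by
  rw [mem_vadd_zono, mem_vadd_zono, AffineEquiv.pointReflection_apply, vsub_eq_sub, vadd_eq_add,
    add_sub_cancel_right, ← neg_sub x z, neg_mem_zono_iff]

lemma pointReflection_image_vadd_zono (z : E) :
    AffineEquiv.pointReflection ℝ z '' (z +ᵥ zono u) = z +ᵥ zono u := by
  apply Set.Subset.antisymm
  · rintro _ ⟨x, hx, rfl⟩
    exact pointReflection_mem_vadd_zono.2 hx
  · intro x hx
    exact ⟨_, pointReflection_mem_vadd_zono.2 hx, AffineEquiv.pointReflection_involutive ℝ z x⟩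

lemma pointReflection_image_zonoFace (z : E) (f : E →ₗ[ℝ] ℝ) :
    AffineEquiv.pointReflection ℝ z '' zonoFace u z f = zonoFace u z (-f) := by
  have key : ∀ (f : E →ₗ[ℝ] ℝ) (x : E), x ∈ zonoFace u z f →
      AffineEquiv.pointReflection ℝ z x ∈ zonoFace u z (-f) := by
    rintro f x ⟨hx, hfx⟩
    rw [zonoFace, Set.mem_ofPred_eq, AffineEquiv.pointReflection_apply, vsub_eq_sub, vadd_eq_add,
      add_sub_cancel_right, ← neg_sub x z, neg_mem_zono_iff]
    exact ⟨hx, by simpa [zonoSupp] using hfx⟩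
  apply Set.Subset.antisymm
  · rintro _ ⟨x, hx, rfl⟩
    exact key f x hx
  · intro x hx
    refine ⟨AffineEquiv.pointReflection ℝ z x, ?_, AffineEquiv.pointReflection_involutive ℝ z x⟩
    simpa using key (-f) x hx

lemma IsFacet.isFlatHyperplane {z : E} (h : (interior (zono u)).Nonempty) {F : Set E}
    (hF : IsFacet (z +ᵥ zono u) F) : IsFlatHyperplane (Set.range u) (vectorSpan ℝ F) := by
  obtain ⟨f, rfl⟩ := hF.1.exists_eq_zonoFace
  have := hF.2
  rw [dim_vadd_zono z h, dim] at this
  exact ⟨vectorSpan_zonoFace (u := u) z f ▸ isFlat_flatSpan _, this⟩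

lemma IsBeltPath.cons {P : Set E} {n : ℕ} {Φ : Fin (n + 1) → Set E} {B : Fin n → Set (Set E)}
    (hp : IsBeltPath P Φ B) {F : Set E} {C : Set (Set E)} (hF : IsFacet P F) (hC : IsBelt P C)
    (hFC : F ∈ C) (hΦ : Φ 0 ∈ C) :
    IsBeltPath P (Fin.cons F Φ : Fin (n + 2) → Set E) (Fin.cons C B : Fin (n + 1) → _) := by
  refine ⟨fun i => ?_, fun i => ?_, fun i => ?_, fun i => ?_⟩
  · cases i using Fin.cases with
    | zero => exact hF
    | succ i => exact hp.isFacet i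
  · cases i using Fin.cases with
    | zero => exact hC
    | succ i => exact hp.isBelt i
  · cases i using Fin.cases with
    | zero => exact hFC
    | succ i => exact hp.left_mem i
  · cases i using Fin.cases with
    | zero => exact hΦ
    | succ i => exact hp.right_mem i

lemma isBeltPath_const {P F : Set E} (hF : IsFacet P F) :
    IsBeltPath P (fun _ : Fin 1 => F) (Fin.elim0 : Fin 0 → Set (Set E)) :=
  ⟨fun _ => hF, fun i => i.elim0, fun i => i.elim0, fun i => i.elim0⟩

variable [FiniteDimensional ℝ E]

lemma isFace_zonoFace (z : E) (f : E →ₗ[ℝ] ℝ) : IsFace (z +ᵥ zono u) (zonoFace u z f) :=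
  ⟨fun _ => ⟨LinearMap.toContinuousLinearMap f, zonoFace_eq z f⟩,
    ⟨_, zonoMax_add_mem_zonoFace z f⟩⟩

lemma exists_isFacet {z : E} (h : (interior (zono u)).Nonempty) {H : Submodule ℝ E}
    (hH : IsFlatHyperplane (Set.range u) H) :
    ∃ F, IsFacet (z +ᵥ zono u) F ∧ vectorSpan ℝ F = H := by
  obtain ⟨f, hf, rfl⟩ := exists_eq_ker hH.2
  have hs : vectorSpan ℝ (zonoFace u z f) = LinearMap.ker f :=
    (vectorSpan_zonoFace z f).trans hH.1
  refine ⟨zonoFace u z f, ⟨isFace_zonoFace z f, ?_⟩, hs⟩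
  rw [dim_vadd_zono z h, dim, hs]
  exact hH.2

/-- Parallel facets of a zonotope are equal or opposite. -/
lemma IsFacet.eq_or_areOpposite {z : E} (h : (interior (zono u)).Nonempty) {F G : Set E}
    (hF : IsFacet (z +ᵥ zono u) F) (hG : IsFacet (z +ᵥ zono u) G)
    (hFG : vectorSpan ℝ F = vectorSpan ℝ G) : F = G ∨ AreOpposite (z +ᵥ zono u) F G := by
  have hF' := hF.isFlatHyperplane h
  have hG' := hG.isFlatHyperplane h
  obtain ⟨f, rfl⟩ := hF.1.exists_eq_zonoFace
  obtain ⟨g, rfl⟩ := hG.1.exists_eq_zonoFace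
  have hne : ∀ f : E →ₗ[ℝ] ℝ, IsFlatHyperplane (Set.range u) (vectorSpan ℝ (zonoFace u z f)) →
      f ≠ 0 := by
    rintro f hf rfl
    have h1 := hf.2
    rw [vectorSpan_zonoFace, LinearMap.ker_zero, flatSpan, top_coe, Set.inter_univ,
      span_range_eq_top_of_interior_zono h, finrank_top] at h1
    omega
  have hker : ∀ f : E →ₗ[ℝ] ℝ, IsFlatHyperplane (Set.range u) (vectorSpan ℝ (zonoFace u z f)) →
      vectorSpan ℝ (zonoFace u z f) = LinearMap.ker f := fun f hf =>
    eq_ker_of_le hf.2 (hne f hf) (vectorSpan_zonoFace (u := u) z f ▸ flatSpan_le _)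
  rw [hker f hF', hker g hG'] at hFG
  obtain ⟨c, hc⟩ : ∃ c : ℝ, g = c • f := by
    obtain ⟨c, hc⟩ := mem_span_singleton.1
      ((_root_.mem_span_of_iInf_ker_le_ker (ι := Unit) (L := fun _ => f) (K := g)
        (by simp [hFG])) |> fun h => by simpa using h)
    exact ⟨c, hc.symm⟩
  rcases lt_trichotomy c 0 with hc0 | rfl | hc0
  · refine Or.inr ⟨z, pointReflection_image_vadd_zono z, ?_⟩
    rw [pointReflection_image_zonoFace, hc, ← zonoFace_smul_of_pos z (-f) (neg_pos.2 hc0)]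
    simp
  · exact absurd (hc.trans (zero_smul ℝ f)) (hne g hG')
  · left
    rw [hc, zonoFace_smul_of_pos z f hc0]

/-- Coordinates transversal to a subspace of codimension two, the first one in general position
with respect to finitely many vectors. -/
lemma exists_transversal_coordinates {L : Submodule ℝ E} (hL : finrank ℝ L + 2 = finrank ℝ E)
    (u : ι → E) : ∃ φ ψ : E →ₗ[ℝ] ℝ, L ≤ LinearMap.ker φ ∧ L ≤ LinearMap.ker ψ ∧
      (∀ g : E →ₗ[ℝ] ℝ, L ≤ LinearMap.ker g → ∃ a b : ℝ, g = a • φ + b • ψ) ∧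
      (∀ i, u i ∉ L → φ (u i) ≠ 0) ∧ ∀ x, φ x = 0 → ψ x = 0 → x ∈ L := by
  have hq : finrank ℝ (E ⧸ L) = finrank ℝ (Fin 2 → ℝ) := by
    have := L.finrank_quotient_add_finrank
    rw [finrank_fin_fun]
    omega
  let e : (E ⧸ L) ≃ₗ[ℝ] (Fin 2 → ℝ) := LinearEquiv.ofFinrankEq _ _ hq
  let p : Fin 2 → E →ₗ[ℝ] ℝ := fun k => LinearMap.proj k ∘ₗ e.toLinearMap ∘ₗ L.mkQ
  have hp : ∀ k x, p k x = e (L.mkQ x) k := fun _ _ => rfl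
  have hpL : ∀ k x, x ∈ L → p k x = 0 := fun k x hx => by
    rw [hp, mkQ_apply, (Quotient.mk_eq_zero L).2 hx, map_zero, Pi.zero_apply]
  have hpL' : ∀ x, p 0 x = 0 → p 1 x = 0 → x ∈ L := fun x h0 h1 => by
    have : e (L.mkQ x) = 0 := by
      ext k
      fin_cases k
      exacts [h0, h1]
    rwa [e.map_eq_zero_iff, mkQ_apply, Quotient.mk_eq_zero] at this
  -- Each generator outside `L` rules out at most one slope `t`, so some real `t` is admissible for
  -- all of them.
  obtain ⟨t, ht⟩ := (Set.finite_range fun i => -(p 0 (u i)) / p 1 (u i)).exists_notMem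
  refine ⟨p 0 + t • p 1, p 1, fun x hx => ?_, fun x hx => hpL 1 x hx, fun g hg => ?_,
    fun i hi h => ?_, fun x h0 h1 => ?_⟩
  · simp [hpL 0 x hx, hpL 1 x hx]
  · let g' : (Fin 2 → ℝ) →ₗ[ℝ] ℝ := L.liftQ g hg ∘ₗ e.symm.toLinearMap
    let c : Fin 2 → ℝ := fun k => g' fun j => if k = j then 1 else 0
    have hg' : ∀ x, g x = c 0 * p 0 x + c 1 * p 1 x := fun x => by
      have h1 : g x = g' (e (L.mkQ x)) := by simp [g']
      rw [h1, LinearMap.pi_apply_eq_sum_univ g' (e (L.mkQ x)), Fin.sum_univ_two, smul_eq_mul,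
        smul_eq_mul, ← hp, ← hp, mul_comm, mul_comm (p 1 x)]
    refine ⟨c 0, c 1 - t * c 0, ?_⟩
    ext x
    simp only [hg' x, LinearMap.add_apply, LinearMap.smul_apply, smul_eq_mul]
    ring
  · rw [LinearMap.add_apply, LinearMap.smul_apply, smul_eq_mul] at h
    by_cases h1 : p 1 (u i) = 0
    · exact hi (hpL' _ (by simpa [h1] using h) h1)
    · refine ht ⟨i, ?_⟩
      simp only
      rw [div_eq_iff h1]
      linarith
  · exact hpL' x (by simpa [h1] using h0) h1

/-- A functional vanishing on `L` but on no generator outside `L` exposes a face with direction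
space exactly `L`. -/
lemma exists_isRidge {z : E} (h : (interior (zono u)).Nonempty) {L : Submodule ℝ E}
    (hL : IsFlatCorankTwo (Set.range u) L) :
    ∃ R, IsRidge (z +ᵥ zono u) R ∧ vectorSpan ℝ R = L := by
  obtain ⟨φ, ψ, hφ, -, -, hne, -⟩ := exists_transversal_coordinates hL.2 u
  have hs : vectorSpan ℝ (zonoFace u z φ) = L := by
    refine (vectorSpan_zonoFace z φ).trans (le_antisymm ?_ (hL.1.le_flatSpan hφ))
    refine span_le.2 ?_
    rintro _ ⟨⟨i, rfl⟩, hi⟩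
    by_contra hiL
    exact hne i hiL hi
  refine ⟨zonoFace u z φ, ⟨isFace_zonoFace z φ, ?_⟩, hs⟩
  rw [dim_vadd_zono z h, dim, hs]
  exact hL.2

/-- Chains of flat hyperplanes lift to belt paths. -/
lemma Linked.exists_isBeltPath {z : E} (h : (interior (zono u)).Nonempty) (k : ℕ) {F G : Set E}
    (hF : IsFacet (z +ᵥ zono u) F) (hG : IsFacet (z +ᵥ zono u) G)
    (hl : Linked (Set.range u) (k + 1) (vectorSpan ℝ F) (vectorSpan ℝ G)) :
    ∃ (Φ : Fin (k + 1 + 1) → Set E) (B : Fin (k + 1) → Set (Set E)),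
      IsBeltPath (z +ᵥ zono u) Φ B ∧ Φ 0 = F ∧ Φ (Fin.last (k + 1)) = G := by
  induction k generalizing F with
  | zero =>
    obtain ⟨H, hH, ⟨L, hL, hLF, hLG⟩, rfl⟩ := hl
    obtain ⟨R, hR, rfl⟩ := exists_isRidge (z := z) h hL
    exact ⟨_, _, (isBeltPath_const hG).cons hF ⟨R, hR, rfl⟩ ⟨hF, hLF⟩ ⟨hG, hLG⟩, rfl, rfl⟩
  | succ k ih =>
    obtain ⟨H, hH, ⟨L, hL, hLF, hLH⟩, hl⟩ := hl
    obtain ⟨R, hR, rfl⟩ := exists_isRidge (z := z) h hL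
    obtain ⟨F', hF', rfl⟩ := exists_isFacet (z := z) h hH
    obtain ⟨Φ, B, hp, rfl, rfl⟩ := ih hF' hl
    exact ⟨_, _, hp.cons hF ⟨R, hR, rfl⟩ ⟨hF, hLF⟩ ⟨hF', hLH⟩, rfl, rfl⟩

/-- For a chain of length zero the facets are only parallel; the convention that opposite facets
have distance `0` covers the case where they differ. -/
lemma beltDist_le_of_linked {z : E} (h : (interior (zono u)).Nonempty) {k : ℕ} {F G : Set E}
    (hF : IsFacet (z +ᵥ zono u) F) (hG : IsFacet (z +ᵥ zono u) G)
    (hl : Linked (Set.range u) k (vectorSpan ℝ F) (vectorSpan ℝ G)) :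
    beltDist (z +ᵥ zono u) F G ≤ k := by
  rw [beltDist]
  split_ifs with ho
  · exact zero_le
  · apply sInf_le
    rcases k with _ | k
    · rcases hF.eq_or_areOpposite h hG hl with rfl | h'
      · exact ⟨0, _, _, isBeltPath_const hF, rfl, rfl, rfl⟩
      · exact absurd h' ho
    · obtain ⟨Φ, B, hp, h0, h1⟩ := hl.exists_isBeltPath h k hF hG
      exact ⟨k + 1, Φ, B, hp, h0, h1, rfl⟩

/-- Under the belt condition the belt diameter is logarithmic in the dimension. -/
theorem beltDiameter_le {z : E} (h : (interior (zono u)).Nonempty)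
    (hs : BeltCondition (Set.range u)) {k : ℕ} (hk : 4 * finrank ℝ E ≤ 5 * 2 ^ k) :
    beltDiameter (z +ᵥ zono u) ≤ k := by
  refine iSup₂_le fun F hF => iSup₂_le fun G hG => ?_
  obtain ⟨j, hj, hl⟩ := hs.exists_linked_le k (hF.isFlatHyperplane h) (hG.isFlatHyperplane h)
    (by omega)
  exact (beltDist_le_of_linked h hF hG hl).trans (by exact_mod_cast hj)

end Zono

/-! ### A planar hexagon inequality; separation and local finiteness in translative tilings. -/

section Tiling

open Module Submodule Filter Topology

/-- A linear functional that is bounded by `K` at the six vertices of a centrally symmetric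
hexagon is less than `K` inside the hexagon. -/
lemma planar_lt_of_mixed_signs {A B G K a b α β r t x y : ℝ} (hG : 0 < G)
    (hβ : β ≤ 0) (h₂ : α * A + β * b = G) (h₃ : α * a + β * B = -G) (hr : 0 < r) (ht : t < 0)
    (hK₂ : |r * A + t * b| ≤ K) (hK₃ : |r * a + t * B| ≤ K) (hx : |x| < A) (hy : |y| < B)
    (hg : |α * x + β * y| < G) : r * x + t * y < K := by
  rw [abs_lt] at hx hy hg
  rw [abs_le] at hK₂ hK₃
  -- Up to a positive factor, `r * x + t * y` is a nonnegative combination of `α * x + β * y` with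
  -- `x` or with `-y`. The bounds on these are attained together at the vertex `(A, b)`,
  -- respectively `(-a, -B)`.
  rcases le_or_gt (r * β) (t * α) with h | h
  · have hβ0 : β < 0 := by
      refine lt_of_le_of_ne hβ fun hβ0 => ?_
      rw [hβ0, mul_zero] at h
      rw [hβ0] at h₂ h₃
      have hA : 0 < A := by linarith
      have h1 : 0 < α := by
        by_contra! hα
        nlinarith
      nlinarith
    have h1 : -t * (α * x + β * y) < -t * G := mul_lt_mul_of_pos_left hg.2 (by linarith)
    have h2 : (t * α - r * β) * x ≤ (t * α - r * β) * A :=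
      mul_le_mul_of_nonneg_left hx.2.le (by linarith)
    have h3 : -β * (r * A + t * b) ≤ -β * K := mul_le_mul_of_nonneg_left hK₂.2 (by linarith)
    have h4 : -β * (r * x + t * y) < -β * K := by
      refine lt_of_lt_of_le ?_ h3
      rw [← h₂] at h1
      linarith
    exact lt_of_mul_lt_mul_left h4 (by linarith)
  · have hα0 : 0 < α := by
      by_contra! hα
      nlinarith
    have h1 : r * (α * x + β * y) < r * G := mul_lt_mul_of_pos_left hg.2 hr
    have h2 : (r * β - t * α) * -y ≤ (r * β - t * α) * B :=
      mul_le_mul_of_nonneg_left (by linarith) (by linarith)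
    have h3 : α * -(r * a + t * B) ≤ α * K := mul_le_mul_of_nonneg_left (by linarith) hα0.le
    have h4 : α * (r * x + t * y) < α * K := by
      refine lt_of_lt_of_le ?_ h3
      have h5 : r * G = -(r * (α * a + β * B)) := by
        rw [h₃]
        ring
      rw [h5] at h1
      linarith
    exact lt_of_mul_lt_mul_left h4 hα0.le

lemma planar_lt_of_same_signs {A B K r t x y : ℝ} (hK : 0 < K) (hrt : 0 ≤ r * t)
    (hK₁ : |r * A + t * B| ≤ K) (hx : |x| < A) (hy : |y| < B) : r * x + t * y < K := by
  have hA : 0 < A := (abs_nonneg x).trans_lt hx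
  have hB : 0 < B := (abs_nonneg y).trans_lt hy
  have h1 : |r * A + t * B| = |r| * A + |t| * B := by
    rw [abs_add_eq_add_abs_iff _ _ |>.2 ?_, abs_mul, abs_mul, abs_of_pos hA, abs_of_pos hB]
    rcases mul_nonneg_iff.1 hrt with ⟨h, h'⟩ | ⟨h, h'⟩
    · exact Or.inl ⟨by positivity, by positivity⟩
    · exact Or.inr ⟨mul_nonpos_of_nonpos_of_nonneg h hA.le,
        mul_nonpos_of_nonpos_of_nonneg h' hB.le⟩
  have h2 : r * x + t * y ≤ |r| * |x| + |t| * |y| := by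
    rw [← abs_mul, ← abs_mul]
    exact add_le_add (le_abs_self _) (le_abs_self _)
  rcases eq_or_ne r 0 with rfl | hr
  · rcases eq_or_ne t 0 with rfl | ht
    · simpa using hK
    · have := mul_lt_mul_of_pos_left hy (abs_pos.2 ht)
      simp only [abs_zero, zero_mul, zero_add] at *
      linarith
  · have := mul_lt_mul_of_pos_left hx (abs_pos.2 hr)
    have := mul_le_mul_of_nonneg_left hy.le (abs_nonneg t)
    linarith

/-- The vertices are `±(A, B)`, `±(A, b)` and `±(a, B)`. The signs of `r` and `t` decide whether the
corner `±(A, B)` or the cut by the third strip controls the maximum. -/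
lemma planar_lt {A B G K a b α β r t x y : ℝ} (hG : 0 < G) (hK : 0 < K)
    (hβ : β ≤ 0) (h₂ : α * A + β * b = G) (h₃ : α * a + β * B = -G)
    (hK₁ : |r * A + t * B| ≤ K) (hK₂ : |r * A + t * b| ≤ K) (hK₃ : |r * a + t * B| ≤ K)
    (hx : |x| < A) (hy : |y| < B) (hg : |α * x + β * y| < G) : r * x + t * y < K := by
  rcases lt_or_ge (r * t) 0 with h | h
  · rcases mul_neg_iff.1 h with ⟨hr, ht⟩ | ⟨hr, ht⟩
    · exact planar_lt_of_mixed_signs hG hβ h₂ h₃ hr ht hK₂ hK₃ hx hy hg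
    · have := planar_lt_of_mixed_signs (K := K) (r := -r) (t := -t) (x := -x) (y := -y) hG hβ h₂ h₃
        (by linarith) (by linarith)
        (by rwa [← abs_neg, show -(-r * A + -t * b) = r * A + t * b by ring])
        (by rwa [← abs_neg, show -(-r * a + -t * B) = r * a + t * B by ring])
        (by rwa [abs_neg]) (by rwa [abs_neg])
        (by rwa [← abs_neg, show -(α * -x + β * -y) = α * x + β * y by ring])
      linarith
  · exact planar_lt_of_same_signs hK h hK₁ hx hy

variable {E : Type*} [NormedAddCommGroup E]

lemma IsTranslativeTiling.of_vadd {A T : Set E} {z : E} (h : IsTranslativeTiling (z +ᵥ A) T) :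
    IsTranslativeTiling A ((fun t => t + z) '' T) := by
  have key : ∀ t : E, t +ᵥ (z +ᵥ A) = (t + z) +ᵥ A := fun t => vadd_vadd t z A
  refine ⟨?_, ?_⟩
  · rw [Set.biUnion_image, ← h.1]
    simp only [key]
  · rintro _ ⟨s, hs, rfl⟩ _ ⟨t, ht, rfl⟩ hst
    have := h.2 hs ht (fun h => hst (h ▸ rfl))
    simpa only [key] using this

lemma IsTranslativeTiling.exists_mem {A T : Set E} (h : IsTranslativeTiling A T) (x : E) :
    ∃ τ ∈ T, x ∈ τ +ᵥ A := by
  have := Set.mem_univ x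
  rw [← h.1] at this
  exact Set.mem_iUnion₂.1 this |>.imp fun τ h => ⟨h.1, h.2⟩

lemma IsTranslativeTiling.exists_separated {A T : Set E} (h : IsTranslativeTiling A T)
    (hA : (interior A).Nonempty) : ∃ δ > 0, T.Pairwise fun s t => δ ≤ dist s t := by
  obtain ⟨c, hc⟩ := hA
  obtain ⟨δ, hδ, hball⟩ := Metric.isOpen_iff.1 isOpen_interior c hc
  refine ⟨δ, hδ, fun s hs t ht hst => ?_⟩
  by_contra! hlt
  have hdisj : Disjoint (interior (s +ᵥ A)) (interior (t +ᵥ A)) := h.2 hs ht hst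
  refine Set.disjoint_left.1 hdisj (?_ : s + c ∈ _) ?_
  · rw [interior_vadd]
    exact ⟨c, hc, rfl⟩
  · rw [interior_vadd]
    refine ⟨s + c - t, hball ?_, by simp⟩
    rw [Metric.mem_ball, dist_eq_norm]
    rw [dist_eq_norm] at hlt
    rwa [show s + c - t - c = s - t by abel]

variable [NormedSpace ℝ E]

/-- Two tiles are separated by a hyperplane. -/
lemma IsTranslativeTiling.exists_separating {A T : Set E} (h : IsTranslativeTiling A T)
    (hA : (interior A).Nonempty) (hc : Convex ℝ A) {σ τ : E} (hσ : σ ∈ T) (hτ : τ ∈ T)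
    (hne : σ ≠ τ) :
    ∃ f : E →ₗ[ℝ] ℝ, f ≠ 0 ∧ ∀ x ∈ σ +ᵥ A, ∀ y ∈ τ +ᵥ A, f x ≤ f y := by
  obtain ⟨f, c, hfσ, hfτ⟩ := geometric_hahn_banach_open_open (hc.vadd σ).interior isOpen_interior
    (hc.vadd τ).interior isOpen_interior (h.2 hσ hτ hne)
  have hne : ∀ ρ : E, (interior (ρ +ᵥ A)).Nonempty := fun ρ => by
    rw [interior_vadd]
    exact hA.vadd_set
  have hcl : ∀ ρ : E, ρ +ᵥ A ⊆ closure (interior (ρ +ᵥ A)) := fun ρ => by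
    rw [(hc.vadd ρ).closure_interior_eq_closure_of_nonempty_interior (hne ρ)]
    exact subset_closure
  refine ⟨f, fun h0 => ?_, fun x hx y hy => ?_⟩
  · obtain ⟨x, hx⟩ := hne σ
    obtain ⟨y, hy⟩ := hne τ
    have h1 := hfσ x hx
    have h2 := hfτ y hy
    have h0' : ∀ x, f x = 0 := fun x => LinearMap.congr_fun h0 x
    rw [h0'] at h1 h2
    linarith
  · have h1 : f x ≤ c := closure_minimal (t := {x | f x ≤ c}) (fun x hx => (hfσ x hx).le)
      (isClosed_le f.continuous continuous_const) (hcl σ hx)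
    have h2 : c ≤ f y := closure_minimal (t := {y | c ≤ f y}) (fun y hy => (hfτ y hy).le)
      (isClosed_le continuous_const f.continuous) (hcl τ hy)
    exact h1.trans h2

variable [FiniteDimensional ℝ E]

lemma IsTranslativeTiling.locallyFinite {A T : Set E} (h : IsTranslativeTiling A T)
    (hA : (interior A).Nonempty) (hb : Bornology.IsBounded A) :
    LocallyFinite fun τ : T => (τ : E) +ᵥ A := by
  have := FiniteDimensional.proper_real E
  obtain ⟨δ, hδ, hsep⟩ := h.exists_separated hA
  obtain ⟨R, hR⟩ := hb.subset_closedBall 0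
  intro x
  refine ⟨Metric.ball x 1, Metric.ball_mem_nhds x one_pos, ?_⟩
  have hfin : {τ : T | (τ : E) ∈ Metric.closedBall x (1 + R)}.Finite := by
    have hpair : Pairwise fun σ τ : T => δ ≤ dist (σ : E) τ := fun σ τ hne =>
      hsep σ.2 τ.2 (Subtype.coe_injective.ne hne)
    have : DiscreteTopology T := .of_forall_le_dist hδ hpair
    exact ((Metric.isClosedEmbedding_of_pairwise_le_dist hδ hpair).isCompact_preimage
      (isCompact_closedBall x (1 + R))).finite_of_discrete
  refine hfin.subset ?_
  rintro τ ⟨y, ⟨w, hw, rfl⟩, hy⟩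
  have h1 := mem_closedBall_zero_iff.1 (hR hw)
  rw [Metric.mem_ball, dist_eq_norm] at hy
  rw [Set.mem_ofPred_eq, Metric.mem_closedBall, dist_eq_norm]
  calc ‖(τ : E) - x‖ = ‖((τ : E) + w - x) - w‖ := by congr 1; abel
    _ ≤ ‖(τ : E) + w - x‖ + ‖w‖ := norm_sub_le _ _
    _ ≤ 1 + R := add_le_add hy.le h1

/-- Tiles are closed and locally finite, so points close to `x` meet no tile that misses `x`. -/
lemma IsTranslativeTiling.eventually_mem {A T : Set E} (h : IsTranslativeTiling A T)
    (hA : (interior A).Nonempty) (hc : IsCompact A) (x : E) :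
    ∀ᶠ y in 𝓝 x, ∀ τ ∈ T, y ∈ τ +ᵥ A → x ∈ τ +ᵥ A := by
  have h1 := (h.locallyFinite hA hc.isBounded).iInter_compl_mem_nhds
    (fun τ => (hc.vadd (τ : E)).isClosed) x
  filter_upwards [h1] with y hy τ hτ hyτ
  by_contra hx
  exact Set.mem_iInter₂.1 hy ⟨τ, hτ⟩ hx hyτ

lemma IsTranslativeTiling.finite_mem {A T : Set E} (h : IsTranslativeTiling A T)
    (hA : (interior A).Nonempty) (hc : IsCompact A) (x : E) :
    {τ | τ ∈ T ∧ x ∈ τ +ᵥ A}.Finite := by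
  refine (((h.locallyFinite hA hc.isBounded).point_finite x).image Subtype.val).subset ?_
  rintro τ ⟨hτ, hx⟩
  exact ⟨⟨τ, hτ⟩, hx, rfl⟩

end Tiling

/-! ### Stable points on a ridge and the tiles across its facets. -/

section Tiling

open Module Submodule Filter Topology

variable {E : Type*} [NormedAddCommGroup E] [NormedSpace ℝ E] {ι : Type*} [Fintype ι] {u : ι → E}

lemma zonoSupp_nonneg (f : E →ₗ[ℝ] ℝ) : 0 ≤ zonoSupp u f :=
  Finset.sum_nonneg fun _ _ => abs_nonneg _

lemma zonoSupp_pos (hu : span ℝ (Set.range u) = ⊤) {f : E →ₗ[ℝ] ℝ} (hf : f ≠ 0) :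
    0 < zonoSupp u f := by
  refine lt_of_le_of_ne (zonoSupp_nonneg f) fun h => hf ?_
  have h0 := (Finset.sum_eq_zero_iff_of_nonneg fun i _ => abs_nonneg (f (u i))).1 h.symm
  refine LinearMap.ext_on_range hu fun i => ?_
  rw [LinearMap.zero_apply, ← abs_eq_zero]
  exact h0 i (Finset.mem_univ i)

/-- A functional nonzero on the direction of a segment centred at `p` in the zonotope does not
attain its extreme values at `p`. -/
lemma abs_apply_lt_zonoSupp {f : E →ₗ[ℝ] ℝ} {p v : E} (h₁ : p + v ∈ zono u) (h₂ : p - v ∈ zono u)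
    (hv : f v ≠ 0) : |f p| < zonoSupp u f := by
  have h1 := abs_le.1 (abs_apply_le_zonoSupp f h₁)
  have h2 := abs_le.1 (abs_apply_le_zonoSupp f h₂)
  rw [map_add] at h1
  rw [map_sub] at h2
  rw [abs_lt]
  rcases hv.lt_or_gt with h | h
  · constructor <;> linarith [h1.1, h1.2, h2.1, h2.2]
  · constructor <;> linarith [h1.1, h1.2, h2.1, h2.2]

/-- A point of the tile `τ +ᵥ zono u` at which `f` is minimal. -/
lemma apply_eq_zonoSupp_of_min {f : E →ₗ[ℝ] ℝ} {x τ : E} (hx : x ∈ τ +ᵥ zono u)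
    (h : ∀ y ∈ τ +ᵥ zono u, f x ≤ f y) : f (τ - x) = zonoSupp u f := by
  have h1 := h (τ + -zonoMax u f)
    (mem_vadd_zono.2 (by simpa using neg_mem_zono (zonoMax_mem (u := u) f)))
  have h2 := abs_le.1 (abs_apply_le_zonoSupp f (mem_vadd_zono.1 hx))
  rw [map_add, map_neg, apply_zonoMax] at h1
  rw [map_sub] at h2 ⊢
  linarith [h2.1]

lemma apply_eq_zonoSupp_of_max {f : E →ₗ[ℝ] ℝ} {x τ : E} (hx : x ∈ τ +ᵥ zono u)
    (h : ∀ y ∈ τ +ᵥ zono u, f y ≤ f x) : f (τ - x) = -zonoSupp u f := by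
  have h1 := apply_eq_zonoSupp_of_min (f := -f) hx fun y hy => by simpa using h y hy
  rw [LinearMap.neg_apply] at h1
  rw [← neg_neg (f (τ - x)), h1]
  simp [zonoSupp]

/-- `x` can be moved a little along each generator killed by `φ` without leaving any of the tiles
that contain it. -/
def IsStable (u : ι → E) (T : Set E) (φ : E →ₗ[ℝ] ℝ) (x : E) : Prop :=
  ∀ τ ∈ T, x ∈ τ +ᵥ zono u → ∀ i, φ (u i) = 0 →
    ∃ ε : ℝ, 0 < ε ∧ x + ε • u i ∈ τ +ᵥ zono u ∧ x - ε • u i ∈ τ +ᵥ zono u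

/-- A functional minimal at `x` over a tile cannot vary along a segment of that tile centred at `x`.
-/
lemma IsStable.apply_eq_zero {T : Set E} {φ f : E →ₗ[ℝ] ℝ} {x τ : E} (h : IsStable u T φ x)
    (hτ : τ ∈ T) (hx : x ∈ τ +ᵥ zono u) (hf : ∀ y ∈ τ +ᵥ zono u, f x ≤ f y) {i : ι}
    (hi : φ (u i) = 0) : f (u i) = 0 := by
  obtain ⟨ε, hε, h1, h2⟩ := h τ hτ hx i hi
  have h1 := hf _ h1
  have h2 := hf _ h2
  rw [map_add, map_smul, smul_eq_mul] at h1
  rw [map_sub, map_smul, smul_eq_mul] at h2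
  have : ε * f (u i) = 0 := by linarith
  exact (mul_eq_zero.1 this).resolve_left hε.ne'

variable [FiniteDimensional ℝ E]

/-- On the face of a tile in direction `φ` there is a stable point. -/
lemma exists_isStable {T : Set E} (hT : IsTranslativeTiling (zono u) T)
    (hint : (interior (zono u)).Nonempty) (φ : E →ₗ[ℝ] ℝ) (τ₁ : E) :
    ∃ x, IsStable u T φ x ∧ ∃ μ : ι → ℝ, (∀ i, |μ i| ≤ 1) ∧ x - τ₁ = ∑ i, μ i • u i ∧
      ∀ i, φ (u i) ≠ 0 → μ i = SignType.sign (φ (u i)) := by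
  classical
  let ν : (ι → ℝ) → ι → ℝ := fun μ i => if φ (u i) = 0 then μ i else SignType.sign (φ (u i))
  let y : (ι → ℝ) → E := fun μ => τ₁ + ∑ i, ν μ i • u i
  let N : (ι → ℝ) → Set E := fun μ => {τ | τ ∈ T ∧ y μ ∈ τ +ᵥ zono u}
  let C : Set (ι → ℝ) := {μ | ∀ i, |μ i| < 1}
  -- Among the points with free coefficients in `(-1, 1)`, take one in the fewest tiles. Nearby
  -- points lie in no new tile, so by minimality they lie in exactly the same tiles.
  obtain ⟨μ, hμ, hmin⟩ : ∃ μ ∈ C, ∀ μ' ∈ C, (N μ).ncard ≤ (N μ').ncard := by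
    have hne : C.Nonempty := ⟨0, fun i => by simp⟩
    exact ⟨_, Function.argminOn_mem (fun μ => (N μ).ncard) C hne,
      fun μ' hμ' => Function.argminOn_le (fun μ => (N μ).ncard) C hμ'⟩
  have hupd : ∀ i, φ (u i) = 0 → ∀ ε : ℝ, y (μ + Pi.single i ε) = y μ + ε • u i := by
    intro i hi ε
    simp only [y, add_assoc]
    congr 1
    have : ε • u i = ∑ j, (Pi.single i ε : ι → ℝ) j • u j := by
      rw [Fintype.sum_eq_single i fun j hj => by rw [Pi.single_eq_of_ne hj, zero_smul],
        Pi.single_eq_same]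
    rw [this, ← Finset.sum_add_distrib]
    refine Finset.sum_congr rfl fun j _ => ?_
    rw [← add_smul]
    congr 1
    by_cases hj : φ (u j) = 0
    · simp [ν, hj]
    · have hji : j ≠ i := fun h => hj (h ▸ hi)
      simp [ν, hj, hji]
  refine ⟨y μ, fun τ hτ hyτ i hi => ?_, ν μ, fun i => ?_, by simp [y], fun i hi => by simp [ν, hi]⟩
  · have hev := hT.eventually_mem hint isCompact_zono (y μ)
    have hcont : ∀ c : ℝ, ∀ᶠ ε in 𝓝 (0 : ℝ), y μ + (c * ε) • u i ∈ τ +ᵥ zono u := by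
      intro c
      have ht : Tendsto (fun ε : ℝ => y μ + (c * ε) • u i) (𝓝 0) (𝓝 (y μ)) := by
        have : Continuous fun ε : ℝ => y μ + (c * ε) • u i := by fun_prop
        simpa using this.tendsto 0
      have hC : ∀ᶠ ε in 𝓝 (0 : ℝ), μ + Pi.single i (c * ε) ∈ C := by
        have hlt : ∀ᶠ ε in 𝓝 (0 : ℝ), |μ i + c * ε| < 1 := by
          have : Continuous fun ε : ℝ => |μ i + c * ε| := by fun_prop
          exact this.tendsto 0 |>.eventually_lt_const (by simpa using hμ i)
        filter_upwards [hlt] with ε hε j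
        by_cases hj : j = i
        · subst hj
          simpa using hε
        · simpa [hj] using hμ j
      filter_upwards [ht.eventually hev, hC] with ε h1 h2
      have hsub : N (μ + Pi.single i (c * ε)) ⊆ N μ := by
        rintro σ ⟨hσ, hσy⟩
        rw [hupd i hi] at hσy
        exact ⟨hσ, h1 σ hσ hσy⟩
      have heq := Set.eq_of_subset_of_ncard_le hsub (hmin _ h2)
        (hT.finite_mem hint isCompact_zono (y μ))
      have hmem : τ ∈ N μ := ⟨hτ, hyτ⟩
      rw [← heq] at hmem
      rw [← hupd i hi]
      exact hmem.2
    obtain ⟨ε, ⟨h1, h2⟩, hε⟩ := (((hcont 1).and (hcont (-1))).filter_mono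
      nhdsWithin_le_nhds |>.and (self_mem_nhdsWithin : Set.Ioi (0 : ℝ) ∈ 𝓝[>] 0)).exists
    exact ⟨ε, hε, by simpa using h1, by simpa [sub_eq_add_neg] using h2⟩
  · by_cases hi : φ (u i) = 0
    · simpa [ν, hi] using (hμ i).le
    · simpa [ν, hi] using abs_sign_le_one _

/-- The tile on the other side of the facet of `τ₁ +ᵥ zono u` in direction `f`. -/
lemma exists_tile_across {T : Set E} (hT : IsTranslativeTiling (zono u) T)
    (hint : (interior (zono u)).Nonempty) {φ f : E →ₗ[ℝ] ℝ} {x τ₁ d : E} (hτ₁ : τ₁ ∈ T)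
    (hx : x ∈ τ₁ +ᵥ zono u) (hst : IsStable u T φ x) (hf : f ≠ 0)
    (hfx : f (x - τ₁) = zonoSupp u f) (hd : ∀ δ : ℝ, 0 ≤ δ → δ ≤ 1 → x + δ • d ∈ τ₁ +ᵥ zono u)
    (hfd : f d = 0)
    (huniq : ∀ g : E →ₗ[ℝ] ℝ, (∀ i, φ (u i) = 0 → g (u i) = 0) → g d = 0 → ∃ c : ℝ, g = c • f) :
    ∃ τ₂ ∈ T, x ∈ τ₂ +ᵥ zono u ∧ (∀ y ∈ τ₂ +ᵥ zono u, f x ≤ f y) ∧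
      ∃ δ : ℝ, 0 < δ ∧ x + δ • d ∈ τ₂ +ᵥ zono u := by
  have hev := hT.eventually_mem hint isCompact_zono x
  -- The tile is found by moving from `x` along the facet by `δ • d`, then out of the first tile by
  -- `ε • s`, both so little that any tile reached still contains `x` and `x + δ • d`.
  obtain ⟨δ, hδ, hδ1, hδev⟩ : ∃ δ : ℝ, 0 < δ ∧ δ ≤ 1 ∧
      ∀ᶠ y in 𝓝 (x + δ • d), ∀ τ ∈ T, y ∈ τ +ᵥ zono u → x ∈ τ +ᵥ zono u := by
    have ht : Tendsto (fun δ : ℝ => x + δ • d) (𝓝[>] 0) (𝓝 x) := by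
      have : Continuous fun δ : ℝ => x + δ • d := by fun_prop
      simpa using (this.tendsto 0).mono_left nhdsWithin_le_nhds
    obtain ⟨δ, h1, h2⟩ := ((ht.eventually hev.eventually_nhds).and
      (Ioc_mem_nhdsGT (zero_lt_one (α := ℝ)))).exists
    exact ⟨δ, h2.1, h2.2, h1⟩
  obtain ⟨s, hs⟩ : ∃ s, 0 < f s := by
    obtain ⟨v, hv⟩ : ∃ v, f v ≠ 0 := by
      by_contra! h
      exact hf (LinearMap.ext h)
    exact ⟨f v • v, by simpa using mul_self_pos.2 hv⟩
  obtain ⟨ε, hε, hεx, hεy⟩ : ∃ ε : ℝ, 0 < ε ∧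
      (∀ τ ∈ T, x + δ • d + ε • s ∈ τ +ᵥ zono u → x ∈ τ +ᵥ zono u) ∧
      ∀ τ ∈ T, x + δ • d + ε • s ∈ τ +ᵥ zono u → x + δ • d ∈ τ +ᵥ zono u := by
    have ht : Tendsto (fun ε : ℝ => x + δ • d + ε • s) (𝓝[>] 0) (𝓝 (x + δ • d)) := by
      have : Continuous fun ε : ℝ => x + δ • d + ε • s := by fun_prop
      simpa using (this.tendsto 0).mono_left nhdsWithin_le_nhds
    obtain ⟨ε, ⟨h1, h2⟩, h3⟩ := (((ht.eventually hδev).and (ht.eventually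
      (hT.eventually_mem hint isCompact_zono (x + δ • d)))).and self_mem_nhdsWithin).exists
    exact ⟨ε, h3, h1, h2⟩
  obtain ⟨τ₂, hτ₂, hmem⟩ := hT.exists_mem (x + δ • d + ε • s)
  have hx₂ := hεx τ₂ hτ₂ hmem
  have hy₂ := hεy τ₂ hτ₂ hmem
  have hne : τ₁ ≠ τ₂ := by
    rintro rfl
    have h1 := apply_le_zonoSupp f (mem_vadd_zono.1 hmem)
    have h2 : x + δ • d + ε • s - τ₁ = (x - τ₁) + δ • d + ε • s := by abel
    rw [h2, map_add, map_add, map_smul, map_smul, hfd, hfx, smul_zero, smul_eq_mul] at h1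
    nlinarith
  obtain ⟨g, hg, hsep⟩ := hT.exists_separating hint convex_zono hτ₁ hτ₂ hne
  -- Both `x` and `x + δ • d` belong to both tiles, so the separating functional is constant along
  -- `d`; with stability this makes it a multiple of `f`.
  have hgd : g d = 0 := by
    have h1 := hsep _ (hd δ hδ.le hδ1) _ hx₂
    have h2 := hsep _ hx _ hy₂
    rw [map_add, map_smul, smul_eq_mul] at h1 h2
    exact (mul_eq_zero.1 (by linarith : δ * g d = 0)).resolve_left hδ.ne'
  obtain ⟨c, rfl⟩ := huniq g (fun i hi => hst.apply_eq_zero hτ₂ hx₂ (hsep x hx) hi) hgd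
  have hc : 0 < c := by
    have h1 := hsep _ hx _ hmem
    rw [map_add, map_add, map_smul, map_smul, hgd, LinearMap.smul_apply, LinearMap.smul_apply,
      smul_zero, smul_eq_mul, smul_eq_mul, smul_eq_mul] at h1
    have h2 : c ≠ 0 := by
      rintro rfl
      exact hg (zero_smul _ _)
    by_contra! h3
    have h4 : c < 0 := lt_of_le_of_ne h3 h2
    have := mul_pos hε hs
    nlinarith
  refine ⟨τ₂, hτ₂, hx₂, fun y hy => ?_, δ, hδ, hy₂⟩
  have h1 := hsep x hx y hy
  rw [LinearMap.smul_apply, LinearMap.smul_apply, smul_eq_mul, smul_eq_mul] at h1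
  exact le_of_mul_le_mul_left h1 hc

end Tiling

/-! ### The belt condition for tiling zonotopes. -/

section Main

open Module Submodule

variable {E : Type*} [NormedAddCommGroup E] [NormedSpace ℝ E] [FiniteDimensional ℝ E]
  {ι : Type*} [Fintype ι] {u : ι → E}

/-- The functionals `f` and `f'` of the two facets through a ridge: they are sign-compatible with
`φ` and vanish on generators `u i` and `u i'` respectively. -/
lemma exists_adjacent_functionals {L : Submodule ℝ E} (hu : span ℝ (Set.range u) = ⊤)
    (hL : finrank ℝ L + 2 = finrank ℝ E) {φ ψ : E →ₗ[ℝ] ℝ} (hφL : L ≤ LinearMap.ker φ)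
    (hψL : L ≤ LinearMap.ker ψ)
    (hspan : ∀ g : E →ₗ[ℝ] ℝ, L ≤ LinearMap.ker g → ∃ a b : ℝ, g = a • φ + b • ψ)
    (hne : ∀ i, u i ∉ L → φ (u i) ≠ 0) (hker : ∀ x, φ x = 0 → ψ x = 0 → x ∈ L) :
    ∃ (f f' : E →ₗ[ℝ] ℝ) (i i' : ι), L ≤ LinearMap.ker f ∧ L ≤ LinearMap.ker f' ∧
      (∀ j, 0 ≤ φ (u j) * f (u j)) ∧ (∀ j, 0 ≤ φ (u j) * f' (u j)) ∧
      f (u i) = 0 ∧ f' (u i') = 0 ∧ 0 < φ (u i) * f' (u i) ∧ 0 < φ (u i') * f (u i') ∧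
      ∀ g : E →ₗ[ℝ] ℝ, L ≤ LinearMap.ker g → ∃ a b : ℝ, g = a • f + b • f' := by
  classical
  have hφker : ∀ j, φ (u j) = 0 → u j ∈ L := fun j hj => by
    by_contra h
    exact hne j h hj
  have hnotle : ∀ f : E →ₗ[ℝ] ℝ, ¬ LinearMap.ker f ≤ L := by
    intro f hle
    have h1 := f.finrank_range_add_finrank_ker
    have h2 : finrank ℝ (LinearMap.range f) ≤ 1 := by
      simpa using (LinearMap.range f).finrank_le
    have h3 := finrank_mono hle
    omega
  have hJ : (Finset.univ.filter fun j => φ (u j) ≠ 0).Nonempty := by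
    by_contra h
    rw [Finset.not_nonempty_iff_eq_empty, Finset.filter_eq_empty_iff] at h
    have h1 : span ℝ (Set.range u) ≤ L := by
      rw [span_le]
      rintro _ ⟨j, rfl⟩
      exact hφker j (not_not.1 (h (Finset.mem_univ j)))
    rw [hu] at h1
    exact hnotle 0 (le_top.trans h1)
  -- Modulo `L` the generators lie in a plane with coordinates `φ`, `ψ`. Those of extreme slope span
  -- the directions of the two facets at the ridge.
  let r : ι → ℝ := fun j => ψ (u j) / φ (u j)
  obtain ⟨i, hi, hmin⟩ := Finset.exists_min_image _ r hJ
  obtain ⟨i', hi', hmax⟩ := Finset.exists_max_image _ r hJ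
  simp only [Finset.mem_filter, Finset.mem_univ, true_and] at hi hi' hmin hmax
  have hψr : ∀ j, ψ (u j) = r j * φ (u j) := fun j => by
    by_cases hj : φ (u j) = 0
    · rw [hj, mul_zero]
      exact hψL (hφker j hj)
    · exact (div_mul_cancel₀ _ hj).symm
  have hlt : r i < r i' := by
    refine lt_of_le_of_ne (hmin i' hi') fun heq => ?_
    have h1 : ψ = r i • φ := by
      refine LinearMap.ext_on_range hu fun j => ?_
      rw [LinearMap.smul_apply, smul_eq_mul, hψr j]
      by_cases hj : φ (u j) = 0
      · rw [hj, mul_zero, mul_zero]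
      · rw [le_antisymm (heq ▸ hmax j hj) (hmin j hj)]
    refine hnotle φ fun x hx => hker x hx ?_
    rw [h1, LinearMap.smul_apply, LinearMap.mem_ker.1 hx, smul_zero]
  have hf : ∀ j, (ψ - r i • φ) (u j) = (r j - r i) * φ (u j) := fun j => by
    rw [LinearMap.sub_apply, LinearMap.smul_apply, hψr j, smul_eq_mul]
    ring
  have hf' : ∀ j, (r i' • φ - ψ) (u j) = (r i' - r j) * φ (u j) := fun j => by
    rw [LinearMap.sub_apply, LinearMap.smul_apply, hψr j, smul_eq_mul]
    ring
  have hmul : ∀ {c : ℝ} (j : ι), (φ (u j) ≠ 0 → 0 ≤ c) → 0 ≤ φ (u j) * (c * φ (u j)) := by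
    intro c j hc
    by_cases hj : φ (u j) = 0
    · simp [hj]
    · rw [mul_left_comm]
      exact mul_nonneg (hc hj) (mul_self_nonneg _)
  refine ⟨ψ - r i • φ, r i' • φ - ψ, i, i', fun x hx => ?_, fun x hx => ?_, fun j => ?_,
    fun j => ?_, ?_, ?_, ?_, ?_, fun g hg => ?_⟩
  · simp [LinearMap.mem_ker.1 (hφL hx), LinearMap.mem_ker.1 (hψL hx)]
  · simp [LinearMap.mem_ker.1 (hφL hx), LinearMap.mem_ker.1 (hψL hx)]
  · rw [hf]
    exact hmul j fun hj => sub_nonneg.2 (hmin j hj)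
  · rw [hf']
    exact hmul j fun hj => sub_nonneg.2 (hmax j hj)
  · rw [hf, sub_self, zero_mul]
  · rw [hf', sub_self, zero_mul]
  · rw [hf', mul_left_comm]
    exact mul_pos (sub_pos.2 hlt) (mul_self_pos.2 hi)
  · rw [hf, mul_left_comm]
    exact mul_pos (sub_pos.2 hlt) (mul_self_pos.2 hi')
  · obtain ⟨a, b, rfl⟩ := hspan g hg
    have hd : r i' - r i ≠ 0 := (sub_pos.2 hlt).ne'
    refine ⟨(a + b * r i) / (r i' - r i) + b, (a + b * r i) / (r i' - r i), ?_⟩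
    ext x
    simp only [LinearMap.add_apply, LinearMap.sub_apply, LinearMap.smul_apply, smul_eq_mul]
    field_simp
    ring

/-- A zonotope that tiles by translates has at most three facet directions around each ridge. -/
theorem IsTranslativeTiling.beltCondition {T : Set E} (hT : IsTranslativeTiling (zono u) T)
    (hint : (interior (zono u)).Nonempty) : BeltCondition (Set.range u) := by
  classical
  intro L hL
  have hu := span_range_eq_top_of_interior_zono hint
  obtain ⟨φ, ψ, hφL, hψL, hspan, hne, hker⟩ := exists_transversal_coordinates hL.2 u
  obtain ⟨f₁, f₂, i₁, i₂, hf₁L, hf₂L, hφf₁, hφf₂, hf₁i, hf₂i, hf₂pos, hf₁pos, hcomb⟩ :=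
    exists_adjacent_functionals hu hL.2 hφL hψL hspan hne hker
  have hφker : ∀ j, φ (u j) = 0 → u j ∈ L := fun j hj => by
    by_contra h
    exact hne j h hj
  have hker_of : ∀ g : E →ₗ[ℝ] ℝ, (∀ j, φ (u j) = 0 → g (u j) = 0) → L ≤ LinearMap.ker g := by
    intro g hg
    rw [← hL.1, span_le]
    rintro _ ⟨⟨j, rfl⟩, hj⟩
    exact hg j (hφL hj)
  have hf₁i₂ : f₁ (u i₂) ≠ 0 := right_ne_zero_of_mul hf₁pos.ne'
  have hf₂i₁ : f₂ (u i₁) ≠ 0 := right_ne_zero_of_mul hf₂pos.ne'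
  have hf₁0 : f₁ ≠ 0 := fun h => hf₁i₂ (by simp [h])
  have hf₂0 : f₂ ≠ 0 := fun h => hf₂i₁ (by simp [h])
  obtain ⟨τ₁, hτ₁, -⟩ := hT.exists_mem 0
  obtain ⟨x, hst, μ, hμ, hxμ, hμφ⟩ := exists_isStable hT hint φ τ₁
  have hx₁ : x ∈ τ₁ +ᵥ zono u := mem_vadd_zono.2 ⟨μ, hμ, hxμ⟩
  have hsupp : ∀ f : E →ₗ[ℝ] ℝ, L ≤ LinearMap.ker f → (∀ j, 0 ≤ φ (u j) * f (u j)) →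
      f (x - τ₁) = zonoSupp u f := by
    intro f hfL hφf
    rw [hxμ, map_sum, zonoSupp]
    refine Finset.sum_congr rfl fun j _ => ?_
    rw [map_smul, smul_eq_mul]
    by_cases hj : φ (u j) = 0
    · rw [LinearMap.mem_ker.1 (hfL (hφker j hj)), mul_zero, abs_zero]
    · rw [hμφ j hj]
      have := hφf j
      rcases lt_or_gt_of_ne hj with h | h
      · rw [sign_neg h, abs_of_nonpos (nonpos_of_mul_nonneg_right this h)]
        simp
      · rw [sign_pos h, abs_of_nonneg (nonneg_of_mul_nonneg_right this h)]
        simp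
  -- At `x` the coefficient of `u i` is the sign of `φ (u i)`, so there is room to move only against
  -- that sign; this leaves the ridge along an edge direction.
  let d : ι → E := fun i => (-(SignType.sign (φ (u i)) : ℝ)) • u i
  have hd : ∀ i, φ (u i) ≠ 0 → ∀ δ : ℝ, 0 ≤ δ → δ ≤ 1 → x + δ • d i ∈ τ₁ +ᵥ zono u := by
    intro i hi δ h0 h1
    rw [mem_vadd_zono, add_sub_right_comm, hxμ]
    refine ⟨fun j => μ j + if j = i then -(δ * SignType.sign (φ (u i))) else 0, fun j => ?_, ?_⟩
    · by_cases hj : j = i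
      · subst hj
        have h2 : μ j + -(δ * SignType.sign (φ (u j))) = SignType.sign (φ (u j)) * (1 - δ) := by
          rw [hμφ j hi]
          ring
        simp only [if_true, h2, abs_mul]
        exact mul_le_one₀ (abs_sign_le_one _) (abs_nonneg _)
          (by rw [abs_of_nonneg] <;> linarith)
      · simpa [hj] using hμ j
    · simp only [add_smul, Finset.sum_add_distrib, ite_smul, zero_smul, Finset.sum_ite_eq',
        Finset.mem_univ, if_true, d, smul_smul, mul_neg]
  have happly_d : ∀ (f : E →ₗ[ℝ] ℝ) (i : ι), 0 < φ (u i) * f (u i) → f (d i) < 0 := by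
    intro f i h
    simp only [d, map_smul, smul_eq_mul]
    rcases mul_pos_iff.1 h with ⟨h1, h2⟩ | ⟨h1, h2⟩
    · rw [sign_pos h1]
      simpa using h2
    · rw [sign_neg h1]
      simpa using h2
  have hd_zero : ∀ (f : E →ₗ[ℝ] ℝ) (i : ι), φ (u i) ≠ 0 → f (d i) = 0 → f (u i) = 0 := by
    intro f i hi h
    simp only [d, map_smul, smul_eq_mul] at h
    refine (mul_eq_zero.1 h).resolve_left (neg_ne_zero.2 ?_)
    rcases lt_or_gt_of_ne hi with h | h <;> simp [h]
  have hφi₁ : φ (u i₁) ≠ 0 := left_ne_zero_of_mul hf₂pos.ne'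
  have hφi₂ : φ (u i₂) ≠ 0 := left_ne_zero_of_mul hf₁pos.ne'
  have hf₁d : f₁ (d i₁) = 0 := by simp [d, hf₁i]
  have hf₂d : f₂ (d i₂) = 0 := by simp [d, hf₂i]
  have hf₂d₁ := happly_d f₂ i₁ hf₂pos
  have hf₁d₂ := happly_d f₁ i₂ hf₁pos
  obtain ⟨τ₂, hτ₂, hx₂, hmin₂, δ₂, hδ₂, hy₂⟩ := exists_tile_across hT hint hτ₁ hx₁ hst hf₁0
    (hsupp f₁ hf₁L hφf₁) (hd i₁ hφi₁) hf₁d (fun g hg hgd => by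
      obtain ⟨a, b, rfl⟩ := hcomb g (hker_of g hg)
      have h1 := hd_zero _ i₁ hφi₁ hgd
      simp only [LinearMap.add_apply, LinearMap.smul_apply, smul_eq_mul, hf₁i, mul_zero,
        zero_add] at h1
      exact ⟨a, by rw [(mul_eq_zero.1 h1).resolve_right hf₂i₁, zero_smul, add_zero]⟩)
  obtain ⟨τ₃, hτ₃, hx₃, hmin₃, δ₃, hδ₃, hy₃⟩ := exists_tile_across hT hint hτ₁ hx₁ hst hf₂0
    (hsupp f₂ hf₂L hφf₂) (hd i₂ hφi₂) hf₂d (fun g hg hgd => by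
      obtain ⟨a, b, rfl⟩ := hcomb g (hker_of g hg)
      have h1 := hd_zero _ i₂ hφi₂ hgd
      simp only [LinearMap.add_apply, LinearMap.smul_apply, smul_eq_mul, hf₂i, mul_zero,
        add_zero] at h1
      exact ⟨b, by rw [(mul_eq_zero.1 h1).resolve_right hf₁i₂, zero_smul, zero_add]⟩)
  have hne₂₃ : τ₃ ≠ τ₂ := by
    rintro rfl
    have h1 := hmin₃ _ hy₂
    rw [map_add, map_smul, smul_eq_mul] at h1
    nlinarith
  obtain ⟨g, hg0, hsep⟩ := hT.exists_separating hint convex_zono hτ₃ hτ₂ hne₂₃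
  have hgL : L ≤ LinearMap.ker g :=
    hker_of g fun j hj => hst.apply_eq_zero hτ₂ hx₂ (hsep x hx₃) hj
  obtain ⟨α, β, hg⟩ := hcomb g hgL
  have hgx : ∀ v, g v = α * f₁ v + β * f₂ v := fun v => by simp [hg]
  -- `g` does not decrease from `τ₃` to `τ₂`, and `x + δ₂ • d i₁` lies in `τ₂`; only `f₂` varies
  -- along `d i₁`, and it decreases.
  have hβ : β ≤ 0 := by
    have h1 := hsep x hx₃ _ hy₂
    rw [map_add, map_smul, smul_eq_mul, hgx (d i₁), hf₁d, mul_zero, zero_add] at h1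
    by_contra! hβ
    have := mul_neg_of_pos_of_neg hδ₂ (mul_neg_of_pos_of_neg hβ hf₂d₁)
    linarith
  have hq₁ : f₁ (τ₁ - x) = -zonoSupp u f₁ := by
    rw [← neg_sub, map_neg, hsupp f₁ hf₁L hφf₁]
  have hq₁' : f₂ (τ₁ - x) = -zonoSupp u f₂ := by
    rw [← neg_sub, map_neg, hsupp f₂ hf₂L hφf₂]
  have hq₂ := apply_eq_zonoSupp_of_min hx₂ hmin₂
  have hq₃ := apply_eq_zonoSupp_of_min hx₃ hmin₃
  have hg₂ := apply_eq_zonoSupp_of_min hx₂ (hsep x hx₃)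
  have hg₃ := apply_eq_zonoSupp_of_max hx₃ fun y hy => hsep y hy x hx₂
  have habs : ∀ (h : E →ₗ[ℝ] ℝ) {τ : E}, x ∈ τ +ᵥ zono u → |h (τ - x)| ≤ zonoSupp u h := by
    intro h τ hτ
    rw [← neg_sub, map_neg, abs_neg]
    exact abs_apply_le_zonoSupp h (mem_vadd_zono.1 hτ)
  refine ⟨![f₁, f₂, g], fun k => ?_, ?_⟩
  · fin_cases k
    exacts [⟨hf₁0, hf₁L⟩, ⟨hf₂0, hf₂L⟩, ⟨hg0, hgL⟩]
  rintro _ ⟨j, rfl⟩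
  by_cases hjL : u j ∈ L
  · exact ⟨0, hf₁L hjL⟩
  by_contra! hcon
  have hc₁ : f₁ (u j) ≠ 0 := hcon 0
  have hc₂ : f₂ (u j) ≠ 0 := hcon 1
  have hc₃ : g (u j) ≠ 0 := hcon 2
  -- The combination of `f₁` and `f₂` that kills `u j`. Its maximiser can be moved both ways along
  -- `u j`, so none of `f₁`, `f₂`, `g` is extremal there.
  let h : E →ₗ[ℝ] ℝ := f₂ (u j) • f₁ + (-f₁ (u j)) • f₂
  have hhx : ∀ v, h v = f₂ (u j) * f₁ v + -f₁ (u j) * f₂ v := fun v => by simp [h]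
  have hhj : h (u j) = 0 := by
    rw [hhx]
    ring
  have hh0 : h ≠ 0 := fun h0 => by
    have h1 := hhx (u i₁)
    rw [h0, hf₁i, LinearMap.zero_apply, mul_zero, zero_add] at h1
    exact mul_ne_zero (neg_ne_zero.2 hc₁) hf₂i₁ h1.symm
  have hp₁ : zonoMax u h + u j ∈ zono u := by
    simpa using zonoMax_add_smul_mem hhj (c := 1) (by simp)
  have hp₂ : zonoMax u h - u j ∈ zono u := by
    simpa [sub_eq_add_neg] using zonoMax_add_smul_mem hhj (c := -1) (by simp)
  have hK := zonoSupp_pos hu hh0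
  -- In the coordinates `(f₁, f₂)` the vectors from `x` to the centres of `τ₁`, `τ₂`, `τ₃` and their
  -- negatives are the six vertices. They lie in the zonotope, so `|h|` is at most its support value
  -- there.
  have hlt := planar_lt (x := f₁ (zonoMax u h)) (y := f₂ (zonoMax u h)) (r := f₂ (u j))
    (t := -f₁ (u j)) (a := f₁ (τ₃ - x)) (b := f₂ (τ₂ - x)) (zonoSupp_pos hu hg0) hK hβ
    (by rw [← hq₂, ← hgx, hg₂]) (by rw [← hq₃, ← hgx, hg₃])
    (by
      have := habs h hx₁
      rwa [hhx, hq₁, hq₁', ← abs_neg, mul_neg, mul_neg, ← neg_add, neg_neg] at this)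
    (by
      have := habs h hx₂
      rwa [hhx, hq₂] at this)
    (by
      have := habs h hx₃
      rwa [hhx, hq₃] at this)
    (abs_apply_lt_zonoSupp hp₁ hp₂ hc₁) (abs_apply_lt_zonoSupp hp₁ hp₂ hc₂)
    (by
      rw [← hgx]
      exact abs_apply_lt_zonoSupp hp₁ hp₂ hc₃)
  rw [← hhx, apply_zonoMax] at hlt
  exact lt_irrefl _ hlt

end Main

end SpaceFilling

theorem mainTheorem1 (d : ℕ) (hd : 1 ≤ d) (P : Set (EuclideanSpace ℝ (Fin d)))
    (hZ : SpaceFilling.IsZonotope P) (hP : SpaceFilling.IsParallelohedron P) :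
    ∃ k : ℕ, SpaceFilling.beltDiameter P = k ∧ (k : ℤ) ≤ ⌈Real.logb 2 (4 / 5 * (d : ℝ))⌉ := by
  obtain ⟨n, u, z, rfl⟩ := hZ.exists_eq_vadd_zono
  obtain ⟨T, hT⟩ := hP.exists_tiling
  have hint : (interior (SpaceFilling.zono u)).Nonempty := by
    have h := hP.full_dimensional
    rw [interior_vadd] at h
    exact Set.vadd_set_nonempty.1 h
  have hd' : (1 : ℝ) ≤ d := by exact_mod_cast hd
  -- Since `d ≥ 1`, the logarithm is at least that of `4/5`, which exceeds `-1`; the ceiling is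
  -- therefore a natural number.
  have hceil : 0 ≤ ⌈Real.logb 2 (4 / 5 * (d : ℝ))⌉ := by
    have h1 : -1 < Real.logb 2 (4 / 5 * (d : ℝ)) := by
      rw [Real.lt_logb_iff_rpow_lt one_lt_two (by positivity), Real.rpow_neg_one]
      linarith
    have h2 : ((-1 : ℤ) : ℝ) < Real.logb 2 (4 / 5 * (d : ℝ)) := by exact_mod_cast h1
    have := Int.lt_ceil.2 h2
    omega
  obtain ⟨m, hm⟩ := Int.eq_ofNat_of_zero_le hceil
  have hdim : 4 * Module.finrank ℝ (EuclideanSpace ℝ (Fin d)) ≤ 5 * 2 ^ m := by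
    rw [finrank_euclideanSpace_fin]
    have h1 : Real.logb 2 (4 / 5 * (d : ℝ)) ≤ m := by
      have := Int.le_ceil (Real.logb 2 (4 / 5 * (d : ℝ)))
      rw [hm] at this
      exact_mod_cast this
    rw [Real.logb_le_iff_le_rpow one_lt_two (by positivity), Real.rpow_natCast] at h1
    have h2 : (4 : ℝ) * d ≤ 5 * 2 ^ m := by linarith
    exact_mod_cast h2
  have hle := SpaceFilling.beltDiameter_le (z := z) hint (hT.of_vadd.beltCondition hint) hdim
  obtain ⟨k, hk⟩ := ENat.ne_top_iff_exists.1 (ne_top_of_le_ne_top (ENat.natCast_ne_top m) hle)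
  refine ⟨k, hk.symm, ?_⟩
  rw [← hk] at hle
  rw [hm]
  exact_mod_cast hle
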